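/- All logarithms are to base $2$. A linear circuit is a straight-line program over $\mathbb{C}$ whose instructions are additions, subtractions and multiplications by complex scalars, each applied to inputs or results of earlier instructions. A bilinear circuit on inputs $X_1,\dots,X_m,Y_1,\dots,Y_n$ consists of a linear circuit with the $X_i$ as inputs, a linear circuit with the $Y_j$ as inputs, multiplications of a value computed from the $X_i$ by a value computed from the $Y_j$ (inputs included), and a linear circuit whose inputs are these products. Its size is its total number of instructions. It is a bounded-coefficient (b.c.) circuit if all its scalars have absolute value at most $2$, and it computes a bilinear map $\varphi$ if each component of $\varphi$ is one of its products or one of the results of its last part. The b.c. complexity $\mathcal{C}(\varphi)$ is the size of a smallest b.c. bilinear circuit computing $\varphi$. Let $\mathrm{conv}_n:\mathbb{C}^n\times\mathbb{C}^n\to\mathbb{C}^n$ be the $n$-dimensional cyclic convolution, $c_k=\sum_{i+j\equiv k \bmod n}a_ib_j$ for $0\le k<n$. Theorem. The b.c. complexity of the cyclic convolution satisfies $$\mathcal{C}(\mathrm{conv}_n)\ \ge\ \tfrac{1}{12}\,n\log n-O(n\log\log n),$$ that is, there is a constant $C$ such that $\mathcal{C}(\mathrm{conv}_n)\ge \tfrac1{12}n\log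 n-C\,n\log\log n$ for all $n\ge 3$. More strongly, the same holds (with another constant $C$) with $\tfrac1{12}$ replaced by $$\max_{0<\epsilon<1}\frac{\epsilon(1-\epsilon)}{2(2-\epsilon)}=\tfrac32-\sqrt2\approx 0.0858.$$ Conversely, there is a constant $C$ such that for every $n\ge 2$ there is a b.c. bilinear circuit of size at most $C\,n\log n$ computing $\mathrm{conv}_n$. -/

import Mathlib

namespace BoundedCoeff

/-- An instruction of a linear circuit, whose operands are among `N` values already available:
an addition, a subtraction, or a multiplication by a complex constant. -/
inductive LinearInstr (N : ℕ) : Type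
  | add (i j : Fin N) : LinearInstr N
  | sub (i j : Fin N) : LinearInstr N
  | smul (c : ℂ) (i : Fin N) : LinearInstr N

/-- The value computed by an instruction from the available values `v`. -/
def LinearInstr.eval {N : ℕ} (v : Fin N → ℂ) : LinearInstr N → ℂ
  | .add i j => v i + v j
  | .sub i j => v i - v j
  | .smul c i => c * v i

/-- Scalar multiplications only by constants of absolute value at most `2`. -/
def LinearInstr.IsBounded {N : ℕ} : LinearInstr N → Prop
  | .add _ _ => True
  | .sub _ _ => True
  | .smul c _ => ‖c‖ ≤ 2

/-- `LinearCircuit n r`: linear straight-line programs with `n` inputs and `r` instructions.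
The operands of each instruction are inputs or results of earlier instructions. -/
inductive LinearCircuit (n : ℕ) : ℕ → Type
  | nil : LinearCircuit n 0
  | snoc {r : ℕ} (Γ : LinearCircuit n r) (ins : LinearInstr (n + r)) : LinearCircuit n (r + 1)

/-- The result sequence on the input `a`: first the `n` inputs, then the `r` computed values. -/
def LinearCircuit.result {n : ℕ} (a : Fin n → ℂ) :
    {r : ℕ} → LinearCircuit n r → Fin (n + r) → ℂ
  | _, .nil => a
  | _, .snoc Γ ins => Fin.snoc (α := fun _ => ℂ) (Γ.result a) (ins.eval (Γ.result a))

/-- A bounded coefficient linear circuit. -/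
def LinearCircuit.IsBounded {n : ℕ} : {r : ℕ} → LinearCircuit n r → Prop
  | _, .nil => True
  | _, .snoc Γ ins => Γ.IsBounded ∧ ins.IsBounded

/-- A bilinear circuit on inputs `X₁, …, X_m` and `Y₁, …, Y_n`, in its four consecutive parts:
a linear circuit in the `X`s, a linear circuit in the `Y`s, multiplications of a linear form in
the `X`s by a linear form in the `Y`s, and a linear circuit having these products as inputs. -/
structure BilinearCircuit (m n : ℕ) where
  /-- Number of instructions of the first part. -/
  r₁ : ℕ
  /-- Number of instructions of the second part. -/
  r₂ : ℕ
  /-- Number of multiplications. -/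
  r₃ : ℕ
  /-- Number of instructions of the last part. -/
  r₄ : ℕ
  /-- The linear circuit in the `X`s. -/
  left : LinearCircuit m r₁
  /-- The linear circuit in the `Y`s. -/
  right : LinearCircuit n r₂
  /-- The operands of the multiplications. -/
  factors : Fin r₃ → Fin (m + r₁) × Fin (n + r₂)
  /-- The linear circuit in the products. -/
  final : LinearCircuit r₃ r₄

namespace BilinearCircuit

variable {m n p : ℕ}

/-- The total number of instructions. -/
def size (Γ : BilinearCircuit m n) : ℕ :=
  Γ.r₁ + Γ.r₂ + Γ.r₃ + Γ.r₄

/-- A bounded coefficient bilinear circuit: every scalar has absolute value at most `2`. -/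
def IsBounded (Γ : BilinearCircuit m n) : Prop :=
  Γ.left.IsBounded ∧ Γ.right.IsBounded ∧ Γ.final.IsBounded

/-- The values of the products on the input `(x, y)`. -/
def products (Γ : BilinearCircuit m n) (x : Fin m → ℂ) (y : Fin n → ℂ) : Fin Γ.r₃ → ℂ :=
  fun s => Γ.left.result x (Γ.factors s).1 * Γ.right.result y (Γ.factors s).2

/-- The products, followed by the results of the last part, on the input `(x, y)`. -/
def result (Γ : BilinearCircuit m n) (x : Fin m → ℂ) (y : Fin n → ℂ) : Fin (Γ.r₃ + Γ.r₄) → ℂ :=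
  Γ.final.result (Γ.products x y)

/-- `Γ` computes `φ`: each component of `φ` occurs in the result sequence. Equality of polynomials
over the infinite field `ℂ` is equality at all points. -/
def Computes (Γ : BilinearCircuit m n)
    (φ : (Fin m → ℂ) →ₗ[ℂ] (Fin n → ℂ) →ₗ[ℂ] (Fin p → ℂ)) : Prop :=
  ∀ k : Fin p, ∃ s : Fin (Γ.r₃ + Γ.r₄), ∀ x y, Γ.result x y s = φ x y k

end BilinearCircuit

/-- The bounded coefficient complexity of a bilinear map: the size of a smallest bounded
coefficient bilinear circuit computing it. -/
noncomputable def bcComplexity {m n p : ℕ}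
    (φ : (Fin m → ℂ) →ₗ[ℂ] (Fin n → ℂ) →ₗ[ℂ] (Fin p → ℂ)) : ℕ :=
  sInf {s | ∃ Γ : BilinearCircuit m n, Γ.IsBounded ∧ Γ.Computes φ ∧ Γ.size = s}

/-- The `n`-dimensional cyclic convolution, `c_k = ∑_{i + j ≡ k mod n} a_i b_j`. -/
noncomputable def conv (n : ℕ) : (Fin n → ℂ) →ₗ[ℂ] (Fin n → ℂ) →ₗ[ℂ] (Fin n → ℂ) :=
  LinearMap.mk₂ ℂ
    (fun a b k => ∑ i : Fin n, ∑ j : Fin n,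
      if (i : ℕ) + (j : ℕ) ≡ (k : ℕ) [MOD n] then a i * b j else 0)
    (by
      intro a a' b; ext k
      simp only [Pi.add_apply, ← Finset.sum_add_distrib]
      refine Finset.sum_congr rfl fun i _ => Finset.sum_congr rfl fun j _ => ?_
      split_ifs
      · exact add_mul _ _ _
      · exact (add_zero 0).symm)
    (by
      intro c a b; ext k
      simp only [Pi.smul_apply, smul_eq_mul, Finset.mul_sum, mul_ite, mul_zero, mul_assoc])
    (by
      intro a b b'; ext k
      simp only [Pi.add_apply, ← Finset.sum_add_distrib]
      refine Finset.sum_congr rfl fun i _ => Finset.sum_congr rfl fun j _ => ?_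
      split_ifs
      · exact mul_add _ _ _
      · exact (add_zero 0).symm)
    (by
      intro c a b; ext k
      simp only [Pi.smul_apply, smul_eq_mul, Finset.mul_sum, mul_ite, mul_zero, mul_left_comm])

end BoundedCoeff

/-! Lower bound. Morgenstern's argument: an instruction with scalars of modulus at most 2 at most
doubles the largest `q × q` minor of the values computed on `q` input vectors (`norm_det_snoc_le`).
A bilinear circuit becomes a linear one once the left input `a` is fixed, but its multiplications
then have the scalars `⟨v s, a⟩`, where `v s` are the linear forms of the left part, and these may
be large. An `a` is needed on which all these forms are small while convolution by `a` still has
many large eigenvalues.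

Let `q = n / 5`. If no subspace of dimension below `q` lay within `δ = 2 ^ (r₁ / q)` of all the `v
s`, greedy orthogonalization would give a `q × q` minor of the left circuit exceeding `δ ^ q = 2 ^
r₁`, against Morgenstern. So such a subspace exists. Projecting a random sign vector orthogonally to
it yields `a`: the forms have size `O(δ log k)` for `k` forms, by an exponential moment bound, and
by second and fourth moments at least `q` of the Fourier coefficients of `a` have squared modulus at
least 1/40 (`exists_small_functionals_large_coordinates`).

The normalized characters are eigenvectors of convolution by `a` with eigenvalues `√n ⟨χ, a⟩`
(`conv_character`). Feeding `q` characters with large coefficient to the right input gives output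
minors that contain the product of these eigenvalues, while the circuit allows at most `2 ^ (r₂ +
r₄)` times the product of `q` scalars. The resulting `pow_le_of_computes_conv` reads, in logarithms,
`q log n ≤ 2 (r₁ + r₂ + r₄) + O(n log log n)`, which gives the constant 1/10. Both required
constants are smaller.

Upper bound. Zero-pad to a power of two `N ≥ 2n`, apply fast Fourier transforms, whose scalars have
modulus 1, multiply pointwise, transform back, and fold the result modulo `n`. -/

namespace BoundedCoeff

open Finset Matrix ComplexConjugate

/-! ### Minors of orthonormal families and Morgenstern's bound -/

/-- A rectangular form of the Cauchy–Binet identity for orthonormal columns. -/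
theorem sum_normSq_det_of_orthonormal {n q : ℕ} {e : Fin q → EuclideanSpace ℂ (Fin n)}
    (he : Orthonormal ℂ e) :
    ∑ p : Fin q → Fin n, ‖(Matrix.of fun i j => e j (p i)).det‖ ^ 2 = (q.factorial : ℝ) := by
  have hdet (p : Fin q → Fin n) : (Matrix.of fun i j => e j (p i)).det =
      ∑ σ : Equiv.Perm (Fin q), ((Equiv.Perm.sign σ : ℤ) : ℂ) * ∏ i, e (σ i) (p i) := by
    rw [← Matrix.det_transpose, Matrix.det_apply']
    rfl
  have hin (i j : Fin q) : ∑ x, conj (e i x) * e j x = if i = j then 1 else 0 := by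
    rw [← orthonormal_iff_ite.1 he i j, PiLp.inner_apply]
    simp [mul_comm]
  have key : (∑ p : Fin q → Fin n, conj (Matrix.of fun i j => e j (p i)).det *
      (Matrix.of fun i j => e j (p i)).det) = (q.factorial : ℂ) := by
    simp only [hdet, map_sum, Finset.sum_mul_sum]
    rw [Finset.sum_comm]
    -- After expanding both determinants, the sum over `p` factors into inner products of the `e (σ
    -- i)` and `e (τ i)`. Only the `q!` diagonal pairs survive.
    have hστ (σ τ : Equiv.Perm (Fin q)) : (∑ p : Fin q → Fin n,
        conj (((Equiv.Perm.sign σ : ℤ) : ℂ) * ∏ i, e (σ i) (p i)) *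
          (((Equiv.Perm.sign τ : ℤ) : ℂ) * ∏ i, e (τ i) (p i))) = if σ = τ then 1 else 0 := by
      have h1 (p : Fin q → Fin n) : conj (((Equiv.Perm.sign σ : ℤ) : ℂ) * ∏ i, e (σ i) (p i)) *
          (((Equiv.Perm.sign τ : ℤ) : ℂ) * ∏ i, e (τ i) (p i)) =
          (((Equiv.Perm.sign σ : ℤ) : ℂ) * ((Equiv.Perm.sign τ : ℤ) : ℂ)) *
            ∏ i, (conj (e (σ i) (p i)) * e (τ i) (p i)) := by
        rw [map_mul, map_prod, Finset.prod_mul_distrib, map_intCast]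
        ring
      simp only [h1]
      rw [← Finset.mul_sum, ← Fintype.prod_sum (fun i x => conj (e (σ i) x) * e (τ i) x)]
      simp only [hin]
      split_ifs with h
      · subst h
        simp only [if_true, Finset.prod_const_one, mul_one]
        rw [← Int.cast_mul, ← Units.val_mul, Int.units_mul_self]
        simp
      · obtain ⟨i, hi⟩ : ∃ i, σ i ≠ τ i := by
          by_contra! hc
          exact h (Equiv.ext hc)
        rw [Finset.prod_eq_zero (Finset.mem_univ i) (if_neg hi), mul_zero]
    simp only [Finset.sum_comm (s := (Finset.univ : Finset (Fin q → Fin n))), hστ]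
    simp [Fintype.card_perm]
  have : ((∑ p : Fin q → Fin n, ‖(Matrix.of fun i j => e j (p i)).det‖ ^ 2 : ℝ) : ℂ)
      = ((q.factorial : ℝ) : ℂ) := by
    push_cast
    rw [← key]
    exact Finset.sum_congr rfl fun p _ => (Complex.conj_mul' _).symm
  exact_mod_cast this

theorem det_eq_zero_of_not_injective {α : Type*} {q : ℕ} (w : α → Fin q → ℂ) {p : Fin q → α}
    (hp : ¬ Function.Injective p) : (Matrix.of fun i j => w (p i) j).det = 0 := by
  simp only [Function.Injective, not_forall] at hp
  obtain ⟨i, j, hij, hne⟩ := hp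
  refine Matrix.det_zero_of_row_eq hne ?_
  ext x
  simp [hij]

/-- The `q!` reorderings of an injective `p` contribute equal terms to a sum of squares whose total
is `q!`. -/
theorem norm_det_le_one_of_orthonormal {n q : ℕ} {e : Fin q → EuclideanSpace ℂ (Fin n)}
    (he : Orthonormal ℂ e) (p : Fin q → Fin n) :
    ‖(Matrix.of fun i j => e j (p i)).det‖ ≤ 1 := by
  by_cases hp : Function.Injective p
  · have hperm (σ : Equiv.Perm (Fin q)) : ‖(Matrix.of fun i j => e j ((p ∘ σ) i)).det‖ ^ 2 =
        ‖(Matrix.of fun i j => e j (p i)).det‖ ^ 2 := by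
      have := Matrix.det_permute σ (Matrix.of fun i j => e j (p i))
      have h2 : (Matrix.of fun i j => e j ((p ∘ σ) i)) =
          (Matrix.of fun i j => e j (p i)).submatrix σ id := rfl
      rw [h2, this, norm_mul]
      rcases Int.units_eq_one_or (Equiv.Perm.sign σ) with h | h <;> simp [h]
    have hinj : Function.Injective fun σ : Equiv.Perm (Fin q) => p ∘ σ := by
      intro σ τ h
      ext i
      exact congrArg Fin.val (hp (congrFun h i))
    have hle : ∑ σ : Equiv.Perm (Fin q), ‖(Matrix.of fun i j => e j ((p ∘ σ) i)).det‖ ^ 2 ≤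
        ∑ p : Fin q → Fin n, ‖(Matrix.of fun i j => e j (p i)).det‖ ^ 2 := by
      rw [← Finset.sum_image (s := Finset.univ) (g := fun σ : Equiv.Perm (Fin q) => p ∘ σ)
        (f := fun p => ‖(Matrix.of fun i j => e j (p i)).det‖ ^ 2) hinj.injOn]
      exact Finset.sum_le_sum_of_subset_of_nonneg (Finset.subset_univ _)
        fun _ _ _ => by positivity
    rw [sum_normSq_det_of_orthonormal he] at hle
    simp only [hperm, Finset.sum_const, Finset.card_univ, Fintype.card_perm, Fintype.card_fin,
      nsmul_eq_mul] at hle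
    have hq : (0 : ℝ) < q.factorial := by exact_mod_cast q.factorial_pos
    have : ‖(Matrix.of fun i j => e j (p i)).det‖ ^ 2 ≤ 1 := by
      by_contra! hc
      nlinarith
    nlinarith [norm_nonneg (Matrix.of fun i j => e j (p i)).det]
  · rw [det_eq_zero_of_not_injective (fun s j => e j s) hp]
    simp

/-- Averaging: the squares sum to `q!`, and only the injective `p` count, of which there are `q! *
n.choose q ≤ q! * 2 ^ n`. -/
theorem exists_one_le_two_pow_mul_normSq_det {n q : ℕ} {e : Fin q → EuclideanSpace ℂ (Fin n)}
    (he : Orthonormal ℂ e) :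
    ∃ p : Fin q → Fin n, 1 ≤ 2 ^ n * ‖(Matrix.of fun i j => e j (p i)).det‖ ^ 2 := by
  by_contra! hc
  classical
  have hq : (0 : ℝ) < q.factorial := by exact_mod_cast q.factorial_pos
  set S := (Finset.univ : Finset (Fin q → Fin n)).filter Function.Injective with hS
  have hsum : ∑ p ∈ S, ‖(Matrix.of fun i j => e j (p i)).det‖ ^ 2 = (q.factorial : ℝ) := by
    rw [← sum_normSq_det_of_orthonormal he, Finset.sum_filter]
    refine Finset.sum_congr rfl fun p _ => ?_
    split_ifs with h
    · rfl
    · rw [det_eq_zero_of_not_injective (fun s j => e j s) h]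
      simp
  have hcard : S.card = n.descFactorial q := by
    have := Fintype.card_embedding_eq (α := Fin q) (β := Fin n)
    rw [Fintype.card_fin, Fintype.card_fin] at this
    rw [← this, ← Fintype.card_subtype,
      Fintype.card_congr (Equiv.subtypeInjectiveEquivEmbedding (Fin q) (Fin n))]
  have hne : S.Nonempty := by
    rw [Finset.nonempty_iff_ne_empty]
    intro h
    rw [h, Finset.sum_empty] at hsum
    exact hq.ne hsum
  have h1 : (2 : ℝ) ^ n * q.factorial < S.card := by
    rw [← hsum, Finset.mul_sum]
    calc _ < ∑ p ∈ S, (1 : ℝ) := Finset.sum_lt_sum_of_nonempty hne fun p _ => hc p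
      _ = S.card := by simp
  have h2 : S.card ≤ 2 ^ n * q.factorial := by
    rw [hcard, Nat.descFactorial_eq_factorial_mul_choose, mul_comm]
    exact Nat.mul_le_mul_right _ (Nat.choose_le_two_pow n q)
  have h3 : (S.card : ℝ) ≤ 2 ^ n * q.factorial := by exact_mod_cast h2
  linarith

/-- Appending a bounded combination of two rows at most doubles the maximal minor. -/
theorem norm_det_snoc_le {N q : ℕ} (w : Fin N → Fin q → ℂ) (ins : LinearInstr N)
    (hins : ins.IsBounded) {K : ℝ} (hK : 0 ≤ K)
    (h : ∀ p : Fin q → Fin N, ‖(Matrix.of fun i j => w (p i) j).det‖ ≤ K)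
    (p : Fin q → Fin (N + 1)) :
    ‖(Matrix.of fun i j =>
      Fin.snoc (α := fun _ => ℂ) (fun s => w s j) (ins.eval fun s => w s j) (p i)).det‖
      ≤ 2 * K := by
  -- A repeated row makes the minor vanish, so the new row may be assumed to occur at most once. The
  -- determinant is linear in that row, and replacing it by an old row gives an old minor.
  by_cases hp : Function.Injective p
  swap
  · rw [det_eq_zero_of_not_injective (fun s j => Fin.snoc (α := fun _ => ℂ) (fun s => w s j)
      (ins.eval fun s => w s j) s) hp]
    simpa using hK
  by_cases hl : ∃ i, p i = Fin.last N
  swap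
  · push Not at hl
    have : p = fun i => (((p i).castPred (hl i)).castSucc) := by ext; simp
    rw [this]
    simp only [Fin.snoc_castSucc]
    linarith [h fun i => (p i).castPred (hl i)]
  obtain ⟨i₀, hi₀⟩ := hl
  have hne (i) (hi : i ≠ i₀) : p i ≠ Fin.last N := fun hc => hi (hp (hc.trans hi₀.symm))
  have hrow (s : Fin N) : ∃ p' : Fin q → Fin N, ∀ i, p' i = s ∧ i = i₀ ∨
      i ≠ i₀ ∧ (p' i).castSucc = p i := by
    refine ⟨fun i => if hi : i = i₀ then s else (p i).castPred (hne i hi), fun i => ?_⟩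
    by_cases hi : i = i₀
    · left; simp [hi]
    · right; simp [hi]
  set M : Matrix (Fin q) (Fin q) ℂ := Matrix.of fun i j =>
      Fin.snoc (α := fun _ => ℂ) (fun s => w s j) (ins.eval fun s => w s j) (p i) with hM
  have hup (s : Fin N) : ‖(M.updateRow i₀ (w s)).det‖ ≤ K := by
    obtain ⟨p', hp'⟩ := hrow s
    convert h p' using 3
    ext i j
    rcases hp' i with ⟨h1, rfl⟩ | ⟨h1, h2⟩
    · simp [h1]
    · rw [Matrix.updateRow_ne h1]
      simp [hM, ← h2]
  have hself : M = M.updateRow i₀ (fun j => ins.eval fun s => w s j) := by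
    ext i j
    by_cases hi : i = i₀
    · subst hi
      simp [hM, hi₀]
    · rw [Matrix.updateRow_ne hi]
  rw [hself]
  cases ins with
  | add a b =>
    have : (fun j => (LinearInstr.add a b).eval fun s => w s j) = w a + w b := rfl
    rw [this, Matrix.det_updateRow_add]
    linarith [norm_add_le (M.updateRow i₀ (w a)).det (M.updateRow i₀ (w b)).det, hup a, hup b]
  | sub a b =>
    have : (fun j => (LinearInstr.sub a b).eval fun s => w s j) = w a + (-1 : ℂ) • w b := by
      ext j
      simp [LinearInstr.eval, sub_eq_add_neg]
    rw [this, Matrix.det_updateRow_add, Matrix.det_updateRow_smul]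
    have h2 := norm_add_le (M.updateRow i₀ (w a)).det (-1 * (M.updateRow i₀ (w b)).det)
    rw [neg_one_mul, norm_neg] at h2
    rw [neg_one_mul]
    linarith [hup a, hup b]
  | smul c a =>
    have : (fun j => (LinearInstr.smul c a).eval fun s => w s j) = c • w a := rfl
    rw [this, Matrix.det_updateRow_smul, norm_mul]
    exact mul_le_mul hins (hup a) (norm_nonneg _) (by norm_num)

/-- Morgenstern's bound: `r` bounded coefficient instructions enlarge the minors by a factor of at
most `2 ^ r`. -/
theorem LinearCircuit.norm_det_result_le {n q : ℕ} (x : Fin q → Fin n → ℂ) {K : ℝ} (hK : 0 ≤ K)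
    (h : ∀ p : Fin q → Fin n, ‖(Matrix.of fun i j => x j (p i)).det‖ ≤ K) :
    ∀ {r : ℕ} (Γ : LinearCircuit n r), Γ.IsBounded → ∀ p : Fin q → Fin (n + r),
      ‖(Matrix.of fun i j => Γ.result (x j) (p i)).det‖ ≤ 2 ^ r * K
  | _, .nil, _, p => by simpa [LinearCircuit.result] using h p
  | r + 1, .snoc Γ ins, hb, p => by
    have := norm_det_snoc_le (fun s j => Γ.result (x j) s) ins hb.2 (by positivity)
      (fun p' => Γ.norm_det_result_le x hK h hb.1 p') p
    rw [pow_succ', mul_assoc]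
    exact this

/-- The coefficients of the values computed by a linear circuit. -/
theorem LinearCircuit.exists_coeff {n : ℕ} : ∀ {r : ℕ} (Γ : LinearCircuit n r),
    ∃ F : Fin (n + r) → Fin n → ℂ, ∀ a s, Γ.result a s = ∑ j, F s j * a j
  | _, .nil => ⟨fun s j => if j = s then 1 else 0, fun a s => by simp [LinearCircuit.result]⟩
  | r + 1, .snoc Γ ins => by
    obtain ⟨F, hF⟩ := Γ.exists_coeff
    refine ⟨fun s j => Fin.snoc (α := fun _ => ℂ) (fun s => F s j) (ins.eval fun s => F s j) s,
      fun a s => ?_⟩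
    refine Fin.lastCases ?_ (fun s => ?_) s
    · cases ins <;> simp [LinearCircuit.result, LinearInstr.eval, hF, ← Finset.sum_add_distrib,
        ← Finset.sum_sub_distrib, Finset.mul_sum, add_mul, sub_mul, mul_assoc]
    · simp [LinearCircuit.result, hF]

end BoundedCoeff
-- Orthogonal residuals and the greedy dichotomy
namespace BoundedCoeff

/-- The component of `x` orthogonal to a finite orthonormal family. -/
noncomputable def residual {E : Type*} [NormedAddCommGroup E] [InnerProductSpace ℂ E] {m : ℕ}
    (e : Fin m → E) (x : E) : E :=
  x - ∑ j, inner ℂ (e j) x • e j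

section residual

variable {E : Type*} [NormedAddCommGroup E] [InnerProductSpace ℂ E] {m : ℕ} {e : Fin m → E}

/-- Self-adjointness of the complementary projection: pairing with a projected sign vector is
pairing the residual with the sign vector itself. -/
theorem inner_residual_left (e : Fin m → E) (x y : E) :
    inner ℂ (residual e x) y = inner ℂ x (residual e y) := by
  simp only [residual, inner_sub_left, inner_sub_right, sum_inner, inner_sum, inner_smul_left,
    inner_smul_right, inner_conj_symm]
  congr 1
  exact Finset.sum_congr rfl fun j _ => mul_comm _ _

theorem inner_self_residual (he : Orthonormal ℂ e) (i : Fin m) (x : E) :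
    inner ℂ (e i) (residual e x) = 0 := by
  rw [residual, inner_sub_right, he.inner_right_fintype, sub_self]

theorem norm_sq_residual (he : Orthonormal ℂ e) (x : E) :
    ‖residual e x‖ ^ 2 = ‖x‖ ^ 2 - ∑ j, ‖inner ℂ (e j) x‖ ^ 2 := by
  have h0 : inner ℂ (∑ j, inner ℂ (e j) x • e j) (residual e x) = (0 : ℂ) := by
    simp only [sum_inner, inner_smul_left, inner_self_residual he, mul_zero,
      Finset.sum_const_zero]
  have h1 : ((‖residual e x‖ ^ 2 : ℝ) : ℂ) =
      ((‖x‖ ^ 2 - ∑ j, ‖inner ℂ (e j) x‖ ^ 2 : ℝ) : ℂ) := by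
    push_cast
    have hn (y : E) : (‖y‖ : ℂ) ^ 2 = inner ℂ y y := (inner_self_eq_norm_sq_to_K y).symm
    rw [hn, hn]
    have h2 : inner ℂ (residual e x) (residual e x) = inner ℂ x (residual e x) -
        inner ℂ (∑ j, inner ℂ (e j) x • e j) (residual e x) := by
      rw [← inner_sub_left]
      rfl
    rw [h2, h0, residual, inner_sub_right, inner_sum, sub_zero]
    congr 1
    refine Finset.sum_congr rfl fun j _ => ?_
    rw [inner_smul_right, ← inner_conj_symm x (e j)]
    exact Complex.mul_conj' _
  exact_mod_cast h1

/-- By Bessel, each `e j` absorbs at most 1 of the total squared mass `n` of the `χ i`. -/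
theorem sum_norm_sq_residual_ge {n : ℕ} (he : Orthonormal ℂ e) {χ : Fin n → E}
    (hχ : Orthonormal ℂ χ) : (n : ℝ) - m ≤ ∑ i, ‖residual e (χ i)‖ ^ 2 := by
  have h1 : ∀ j, ∑ i, ‖inner ℂ (e j) (χ i)‖ ^ 2 ≤ (1 : ℝ) := fun j => by
    have := hχ.sum_inner_products_le (e j) (s := Finset.univ)
    rw [he.1 j, one_pow] at this
    simpa only [norm_inner_symm (e j)] using this
  simp only [norm_sq_residual he, hχ.1, Finset.sum_sub_distrib]
  rw [Finset.sum_comm]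
  have := Finset.sum_le_sum fun j (_ : j ∈ Finset.univ) => h1 j
  simp at this ⊢
  linarith

/-- Greedy construction: either all vectors `v s` are within `δ` of a subspace of small dimension,
or there are `r` of them spanning a parallelepiped with large edges. -/
theorem exists_rigid_or_triangular {ι : Type*} (v : ι → E) (δ : ℝ) (hδ : 0 ≤ δ) (r : ℕ) :
    (∃ m < r, ∃ e : Fin m → E, Orthonormal ℂ e ∧ ∀ s, ‖residual e (v s)‖ ≤ δ) ∨
    ∃ (e : Fin r → E) (t : Fin r → ι), Orthonormal ℂ e ∧
      (∀ l, v (t l) ∈ Submodule.span ℂ (Set.range e)) ∧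
      (∀ l j, l < j → inner ℂ (v (t l)) (e j) = (0 : ℂ)) ∧
      ∀ l, δ < ‖inner ℂ (v (t l)) (e l)‖ := by
  induction r with
  | zero =>
    right
    exact ⟨Fin.elim0, Fin.elim0, ⟨fun i => i.elim0, fun i => i.elim0⟩, fun i => i.elim0,
      fun i => i.elim0, fun i => i.elim0⟩
  | succ r ih =>
    rcases ih with ⟨m, hm, h⟩ | ⟨e, t, he, hspan, htri, hdiag⟩
    · exact Or.inl ⟨m, by omega, h⟩
    by_cases hall : ∀ s, ‖residual e (v s)‖ ≤ δ
    · exact Or.inl ⟨r, by omega, e, he, hall⟩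
    right
    push Not at hall
    obtain ⟨s, hs⟩ := hall
    have hpos : 0 < ‖residual e (v s)‖ := lt_of_le_of_lt hδ hs
    set ρ := residual e (v s) with hρ
    -- A Gram–Schmidt step: the new diagonal entry is the residual's norm, which exceeds `δ`.
    -- Earlier chosen vectors lie in the old span, hence are orthogonal to `u`.
    set u : E := ((‖ρ‖ : ℂ)⁻¹) • ρ with hu
    have hnu : ‖u‖ = 1 := by
      rw [hu, norm_smul, norm_inv, Complex.norm_real, norm_norm, inv_mul_cancel₀ hpos.ne']
    have heu (i) : inner ℂ (e i) u = (0 : ℂ) := by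
      rw [hu, inner_smul_right, inner_self_residual he, mul_zero]
    have hue (i) : inner ℂ u (e i) = (0 : ℂ) := by
      rw [← inner_conj_symm, heu, map_zero]
    have hρu : ρ = (‖ρ‖ : ℂ) • u := by
      rw [hu, smul_smul, mul_inv_cancel₀ (by exact_mod_cast hpos.ne'), one_smul]
    have hsum : ∑ j, inner ℂ (e j) (v s) • e j ∈ Submodule.span ℂ (Set.range e) :=
      Submodule.sum_mem _ fun j _ => Submodule.smul_mem _ _ (Submodule.subset_span ⟨j, rfl⟩)
    have horth : ∀ x ∈ Submodule.span ℂ (Set.range e), inner ℂ x u = (0 : ℂ) := by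
      intro x hx
      induction hx using Submodule.span_induction with
      | mem x hx => obtain ⟨i, rfl⟩ := hx; exact heu i
      | zero => exact inner_zero_left _
      | add x y _ _ hx hy => rw [inner_add_left, hx, hy, add_zero]
      | smul c x _ hx => rw [inner_smul_left, hx, mul_zero]
    have hvs : v s = (‖ρ‖ : ℂ) • u + ∑ j, inner ℂ (e j) (v s) • e j := by
      rw [← hρu, hρ, residual, sub_add_cancel]
    have hmono : Submodule.span ℂ (Set.range e) ≤
        Submodule.span ℂ (Set.range (Fin.snoc (α := fun _ => E) e u)) := by
      refine Submodule.span_mono ?_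
      rintro _ ⟨i, rfl⟩
      exact ⟨i.castSucc, by simp⟩
    refine ⟨Fin.snoc (α := fun _ => E) e u, Fin.snoc (α := fun _ => ι) t s, ?_, ?_, ?_, ?_⟩
    · rw [orthonormal_iff_ite]
      intro i j
      refine Fin.lastCases ?_ (fun i => ?_) i <;> refine Fin.lastCases ?_ (fun j => ?_) j
      · simp [inner_self_eq_norm_sq_to_K, hnu]
      · simp [hue, (Fin.castSucc_lt_last j).ne']
      · simp [heu, (Fin.castSucc_lt_last i).ne]
      · simp [orthonormal_iff_ite.1 he]
    · intro l
      refine Fin.lastCases ?_ (fun l => ?_) l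
      · rw [Fin.snoc_last, hvs]
        exact Submodule.add_mem _ (Submodule.smul_mem _ _
          (Submodule.subset_span ⟨Fin.last r, by simp⟩)) (hmono hsum)
      · rw [Fin.snoc_castSucc]
        exact hmono (hspan l)
    · intro l j hlj
      induction l using Fin.lastCases with
      | last => exact absurd hlj (not_lt.2 (Fin.le_last j))
      | cast l =>
        induction j using Fin.lastCases with
        | last => simpa using horth _ (hspan l)
        | cast j => simpa using htri l j (by simpa using hlj)
    · intro l
      refine Fin.lastCases ?_ (fun l => ?_) l
      · have : inner ℂ (v s) u = (‖ρ‖ : ℂ) := by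
          rw [hvs, inner_add_left, horth _ hsum, inner_smul_left, inner_self_eq_norm_sq_to_K, hnu]
          simp
        simpa [this] using hs
      · simpa using hdiag l

end residual

end BoundedCoeff
-- Moments of random signed sums, and the choice of the left input
namespace BoundedCoeff

open ComplexConjugate

/-- The signed sum of `c` with signs `ξ`. -/
noncomputable def signSum {E : Type*} [AddCommGroup E] {n : ℕ} (c : Fin n → E)
    (ξ : Fin n → Bool) : E :=
  ∑ j, if ξ j then c j else -c j

section signSum

theorem sum_bool_fun_succ {E : Type*} [AddCommMonoid E] {n : ℕ} (f : (Fin (n + 1) → Bool) → E) :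
    ∑ ξ, f ξ = ∑ ξ : Fin n → Bool, (f (Fin.cons true ξ) + f (Fin.cons false ξ)) := by
  rw [← (Fin.consEquiv fun _ => Bool).sum_comp f, Fintype.sum_prod_type, Finset.sum_comm]
  simp [Fin.consEquiv]

theorem signSum_cons_true {E : Type*} [AddCommGroup E] {n : ℕ} (c : Fin (n + 1) → E)
    (ξ : Fin n → Bool) :
    signSum c (Fin.cons true ξ) = c 0 + signSum (fun j => c j.succ) ξ := by
  simp [signSum, Fin.sum_univ_succ]

theorem signSum_cons_false {E : Type*} [AddCommGroup E] {n : ℕ} (c : Fin (n + 1) → E)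
    (ξ : Fin n → Bool) :
    signSum c (Fin.cons false ξ) = -c 0 + signSum (fun j => c j.succ) ξ := by
  simp [signSum, Fin.sum_univ_succ]

theorem sum_norm_sq_signSum : ∀ {n : ℕ} (c : Fin n → ℂ),
    ∑ ξ, ‖signSum c ξ‖ ^ 2 = 2 ^ n * ∑ j, ‖c j‖ ^ 2
  | 0, c => by simp [signSum]
  | n + 1, c => by
    have h (x y : ℂ) : ‖x + y‖ ^ 2 + ‖-x + y‖ ^ 2 = 2 * ‖x‖ ^ 2 + 2 * ‖y‖ ^ 2 := by
      simp only [← Complex.normSq_eq_norm_sq, Complex.normSq_apply, Complex.add_re,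
        Complex.add_im, Complex.neg_re, Complex.neg_im]
      ring
    rw [sum_bool_fun_succ]
    simp only [signSum_cons_true, signSum_cons_false, h]
    rw [Finset.sum_add_distrib, ← Finset.mul_sum, ← Finset.mul_sum, sum_norm_sq_signSum fun j => c j.succ,
      Fin.sum_univ_succ (fun j => ‖c j‖ ^ 2)]
    simp
    ring

/-- Khintchine's inequality for the fourth moment. Averaging over one sign removes the odd cross
terms, and Cauchy–Schwarz bounds the rest. -/
theorem sum_norm_pow_four_signSum_le : ∀ {n : ℕ} (c : Fin n → ℂ),
    ∑ ξ, ‖signSum c ξ‖ ^ 4 ≤ 2 ^ n * (3 * (∑ j, ‖c j‖ ^ 2) ^ 2)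
  | 0, c => by simp [signSum]
  | n + 1, c => by
    have h (x y : ℂ) : ‖x + y‖ ^ 4 + ‖-x + y‖ ^ 4 ≤
        2 * ‖x‖ ^ 4 + 12 * ‖x‖ ^ 2 * ‖y‖ ^ 2 + 2 * ‖y‖ ^ 4 := by
      have h4 (z : ℂ) : ‖z‖ ^ 4 = (‖z‖ ^ 2) ^ 2 := by ring
      simp only [h4, ← Complex.normSq_eq_norm_sq, Complex.normSq_apply, Complex.add_re,
        Complex.add_im, Complex.neg_re, Complex.neg_im]
      nlinarith [sq_nonneg (x.re * y.im - x.im * y.re)]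
    have ih := sum_norm_pow_four_signSum_le fun j : Fin n => c j.succ
    have ih2 := sum_norm_sq_signSum fun j : Fin n => c j.succ
    set V := ∑ j : Fin n, ‖c j.succ‖ ^ 2
    have : ∑ ξ, ‖signSum c ξ‖ ^ 4 ≤ ∑ ξ : Fin n → Bool, (2 * ‖c 0‖ ^ 4 +
        12 * ‖c 0‖ ^ 2 * ‖signSum (fun j => c j.succ) ξ‖ ^ 2 +
        2 * ‖signSum (fun j => c j.succ) ξ‖ ^ 4) := by
      simp only [sum_bool_fun_succ, signSum_cons_true, signSum_cons_false]
      exact Finset.sum_le_sum fun ξ _ => h _ _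
    refine this.trans ?_
    rw [Finset.sum_add_distrib, Finset.sum_add_distrib, ← Finset.mul_sum, ← Finset.mul_sum,
      ← Finset.mul_sum, ih2,
      Fin.sum_univ_succ (fun j => ‖c j‖ ^ 2)]
    change _ ≤ 2 ^ (n + 1) * (3 * (‖c 0‖ ^ 2 + V) ^ 2)
    simp only [Finset.sum_const, Finset.card_univ, Fintype.card_fun, Fintype.card_bool,
      Fintype.card_fin, nsmul_eq_mul, Nat.cast_pow, Nat.cast_ofNat]
    have : 0 ≤ (2 : ℝ) ^ n * ‖c 0‖ ^ 4 := by positivity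
    rw [pow_succ 2 n]
    nlinarith

/-- Subgaussian bound: summing over one sign splits off a factor `2 cosh (c 0)`, and `cosh x ≤ exp
(x ^ 2 / 2)`. -/
theorem sum_cosh_signSum_le : ∀ {n : ℕ} (c : Fin n → ℝ),
    ∑ ξ, Real.cosh (signSum c ξ) ≤ 2 ^ n * Real.exp ((∑ j, c j ^ 2) / 2)
  | 0, c => by simp [signSum]
  | n + 1, c => by
    have h (x y : ℝ) : Real.cosh (x + y) + Real.cosh (-x + y) =
        2 * Real.cosh x * Real.cosh y := by
      rw [Real.cosh_add, Real.cosh_add, Real.cosh_neg, Real.sinh_neg]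
      ring
    have ih := sum_cosh_signSum_le fun j : Fin n => c j.succ
    simp only [sum_bool_fun_succ, signSum_cons_true, signSum_cons_false, h]
    rw [← Finset.mul_sum, Fin.sum_univ_succ, add_div, Real.exp_add, pow_succ]
    calc _ ≤ (2 * Real.exp (c 0 ^ 2 / 2)) *
          (2 ^ n * Real.exp ((∑ j : Fin n, c j.succ ^ 2) / 2)) := by
          gcongr
          exact Real.cosh_le_exp_half_sq _
      _ = _ := by ring

theorem re_signSum {n : ℕ} (c : Fin n → ℂ) (ξ : Fin n → Bool) :
    (signSum c ξ).re = signSum (fun j => (c j).re) ξ := by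
  simp only [signSum, Complex.re_sum]
  exact Finset.sum_congr rfl fun j _ => by split_ifs <;> simp

theorem im_signSum {n : ℕ} (c : Fin n → ℂ) (ξ : Fin n → Bool) :
    (signSum c ξ).im = signSum (fun j => (c j).im) ξ := by
  simp only [signSum, Complex.im_sum]
  exact Finset.sum_congr rfl fun j _ => by split_ifs <;> simp

theorem signSum_div {n : ℕ} (c : Fin n → ℝ) (d : ℝ) (ξ : Fin n → Bool) :
    signSum c ξ / d = signSum (fun j => c j / d) ξ := by
  simp only [signSum, Finset.sum_div]
  exact Finset.sum_congr rfl fun j _ => by split_ifs <;> simp [neg_div]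

/-- The sign vector of `ξ`. -/
noncomputable def signVec {n : ℕ} (ξ : Fin n → Bool) : EuclideanSpace ℂ (Fin n) :=
  WithLp.toLp 2 fun j => if ξ j then 1 else -1

theorem inner_signVec {n : ℕ} (x : EuclideanSpace ℂ (Fin n)) (ξ : Fin n → Bool) :
    inner ℂ x (signVec ξ) = signSum (fun j => conj (x j)) ξ := by
  simp only [PiLp.inner_apply, signVec, signSum]
  exact Finset.sum_congr rfl fun j _ => by split_ifs <;> simp

theorem sum_norm_sq_inner_signVec {n : ℕ} (x : EuclideanSpace ℂ (Fin n)) :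
    ∑ ξ, ‖inner ℂ x (signVec ξ)‖ ^ 2 = 2 ^ n * ‖x‖ ^ 2 := by
  simp [inner_signVec, sum_norm_sq_signSum, EuclideanSpace.norm_sq_eq]

theorem sum_norm_pow_four_inner_signVec_le {n : ℕ} (x : EuclideanSpace ℂ (Fin n)) :
    ∑ ξ, ‖inner ℂ x (signVec ξ)‖ ^ 4 ≤ 2 ^ n * (3 * (‖x‖ ^ 2) ^ 2) := by
  have := sum_norm_pow_four_signSum_le fun j => conj (x j)
  simpa [inner_signVec, EuclideanSpace.norm_sq_eq] using this

theorem sum_cosh_inner_signVec_le {n : ℕ} (x : EuclideanSpace ℂ (Fin n)) {δ : ℝ} (hδ : 0 < δ)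
    (hx : ‖x‖ ≤ δ) :
    ∑ ξ, (Real.cosh ((inner ℂ x (signVec ξ)).re / δ) +
      Real.cosh ((inner ℂ x (signVec ξ)).im / δ)) ≤ 2 ^ n * 4 := by
  have hx2 : ∑ j, ‖x j‖ ^ 2 ≤ δ ^ 2 := by
    rw [← EuclideanSpace.norm_sq_eq]
    gcongr
  have he : Real.exp (1 / 2) ≤ 2 := by
    have h1 : Real.exp (1 / 2) ^ 2 = Real.exp 1 := by
      rw [← Real.exp_nat_mul]
      norm_num
    nlinarith [Real.exp_one_lt_d9, Real.exp_pos (1 / 2)]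
  have key (c : Fin n → ℝ) (hc : ∀ j, c j ^ 2 ≤ ‖x j‖ ^ 2) :
      ∑ ξ, Real.cosh (signSum c ξ / δ) ≤ 2 ^ n * 2 := by
    simp only [signSum_div]
    refine (sum_cosh_signSum_le _).trans ?_
    gcongr
    refine le_trans (Real.exp_le_exp.2 ?_) he
    gcongr
    simp only [div_pow]
    rw [← Finset.sum_div, div_le_one (by positivity)]
    exact (Finset.sum_le_sum fun j _ => hc j).trans hx2
  simp only [inner_signVec, re_signSum, im_signSum]
  rw [Finset.sum_add_distrib]
  have h1 := key (fun j => (conj (x j)).re) fun j => by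
    rw [← Complex.normSq_eq_norm_sq, Complex.normSq_apply, Complex.conj_re]
    nlinarith [sq_nonneg (x j).im]
  have h2 := key (fun j => (conj (x j)).im) fun j => by
    rw [← Complex.normSq_eq_norm_sq, Complex.normSq_apply, Complex.conj_im]
    nlinarith [sq_nonneg (x j).re]
  linarith

end signSum

theorem abs_le_log_of_cosh_le {x y : ℝ} (h : Real.cosh x ≤ y) : |x| ≤ Real.log (2 * y) := by
  rw [Real.le_log_iff_exp_le (by linarith [Real.cosh_pos x])]
  rw [← Real.cosh_abs, Real.cosh_eq] at h
  linarith [Real.exp_pos (-|x|)]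

/-- A vector, orthogonal to a given small orthonormal family, on which all the functionals `v s`
are small but many of the coordinates with respect to `χ` are not. -/
theorem exists_small_functionals_large_coordinates {n m k : ℕ} (hn : 0 < n) (hm : m ≤ n)
    {χ : Fin n → EuclideanSpace ℂ (Fin n)} (hχ : Orthonormal ℂ χ)
    {e : Fin m → EuclideanSpace ℂ (Fin n)} (he : Orthonormal ℂ e)
    (v : Fin k → EuclideanSpace ℂ (Fin n)) {δ : ℝ} (hδ : 0 < δ)
    (hv : ∀ s, ‖residual e (v s)‖ ≤ δ) :
    ∃ (a : EuclideanSpace ℂ (Fin n)) (Q : Finset (Fin n)),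
      (∀ s, ‖inner ℂ (v s) a‖ ≤ 2 * δ * Real.log (500 * k)) ∧
      (∀ i ∈ Q, 1 / 40 ≤ ‖inner ℂ (χ i) a‖ ^ 2) ∧
      ((n : ℝ) - m) / 3 - n / 30 ≤ Q.card := by
  classical
  set Z : Fin n → (Fin n → Bool) → ℂ := fun i ξ => inner ℂ (residual e (χ i)) (signVec ξ) with hZ
  set W : Fin k → (Fin n → Bool) → ℂ := fun s ξ => inner ℂ (residual e (v s)) (signVec ξ) with hW
  set H : Fin k → (Fin n → Bool) → ℝ := fun s ξ =>
    Real.cosh ((W s ξ).re / δ) + Real.cosh ((W s ξ).im / δ) with hH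
  have hH0 (s ξ) : 0 ≤ H s ξ := add_nonneg (Real.cosh_pos _).le (Real.cosh_pos _).le
  have hn' : (0 : ℝ) < n := by exact_mod_cast hn
  -- One averaged quantity yields both properties. The quartic term caps the contribution of each
  -- coordinate, while its mean stays at least half of the squared residual. The penalty weight is
  -- such that its mean is at most `n / 40`.
  obtain ⟨ξ, hξ⟩ : ∃ ξ, ((n : ℝ) - m) / 2 - n / 40 ≤
      ∑ i, (‖Z i ξ‖ ^ 2 - ‖Z i ξ‖ ^ 4 / 6) - (n / (160 * k)) * ∑ s, H s ξ := by
    by_contra! hc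
    have hlt := Finset.sum_lt_sum_of_nonempty (Finset.univ_nonempty (α := Fin n → Bool))
      fun ξ _ => hc ξ
    have h1 (i) : 2 ^ n * (‖residual e (χ i)‖ ^ 2 / 2) ≤
        ∑ ξ, (‖Z i ξ‖ ^ 2 - ‖Z i ξ‖ ^ 4 / 6) := by
      have ha := sum_norm_sq_inner_signVec (residual e (χ i))
      have hb := sum_norm_pow_four_inner_signVec_le (residual e (χ i))
      have hle : ‖residual e (χ i)‖ ^ 2 ≤ 1 := by
        rw [norm_sq_residual he, hχ.1]
        have : 0 ≤ ∑ j, ‖inner ℂ (e j) (χ i)‖ ^ 2 := Finset.sum_nonneg fun _ _ => by positivity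
        linarith
      have hsq : (‖residual e (χ i)‖ ^ 2) ^ 2 ≤ ‖residual e (χ i)‖ ^ 2 := by
        nlinarith [sq_nonneg ‖residual e (χ i)‖]
      rw [Finset.sum_sub_distrib, ← Finset.sum_div, ha]
      have : (2 : ℝ) ^ n * (3 * (‖residual e (χ i)‖ ^ 2) ^ 2) ≤
        2 ^ n * (3 * ‖residual e (χ i)‖ ^ 2) := by gcongr
      linarith
    have h2 : 2 ^ n * (((n : ℝ) - m) / 2) ≤ ∑ ξ, ∑ i, (‖Z i ξ‖ ^ 2 - ‖Z i ξ‖ ^ 4 / 6) := by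
      rw [Finset.sum_comm]
      refine le_trans ?_ (Finset.sum_le_sum fun i _ => h1 i)
      rw [← Finset.mul_sum, ← Finset.sum_div]
      gcongr
      exact sum_norm_sq_residual_ge he hχ
    have h3 : (n / (160 * k) : ℝ) * ∑ ξ, ∑ s, H s ξ ≤ 2 ^ n * (n / 40) := by
      have : ∑ ξ, ∑ s, H s ξ ≤ k * (2 ^ n * 4) := by
        rw [Finset.sum_comm]
        refine (Finset.sum_le_sum fun s _ => sum_cosh_inner_signVec_le _ hδ (hv s)).trans ?_
        simp
      rcases Nat.eq_zero_or_pos k with rfl | hk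
      · simp only [Nat.cast_zero, mul_zero, div_zero, zero_mul]
        positivity
      have hk' : (0 : ℝ) < k := by exact_mod_cast hk
      calc _ ≤ (n / (160 * k) : ℝ) * (k * (2 ^ n * 4)) := by gcongr
        _ = _ := by field_simp; ring
    rw [Finset.sum_sub_distrib, ← Finset.mul_sum] at hlt
    simp only [Finset.sum_const, Finset.card_univ, Fintype.card_fun, Fintype.card_bool,
      Fintype.card_fin, nsmul_eq_mul, Nat.cast_pow, Nat.cast_ofNat] at hlt
    linarith
  have hinner (x : EuclideanSpace ℂ (Fin n)) : inner ℂ x (residual e (signVec ξ)) =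
    inner ℂ (residual e x) (signVec ξ) := (inner_residual_left e x _).symm
  -- The maximum, attained at `t ^ 2 = 3`.
  have hquad (t : ℝ) : t ^ 2 - t ^ 4 / 6 ≤ 3 / 2 := by nlinarith [sq_nonneg (t ^ 2 - 3)]
  have hm' : (m : ℝ) ≤ n := by exact_mod_cast hm
  refine ⟨residual e (signVec ξ), Finset.univ.filter fun i => 1 / 40 ≤ ‖Z i ξ‖ ^ 2, ?_, ?_, ?_⟩
  · intro s
    rw [hinner]
    change ‖W s ξ‖ ≤ _
    have hk : 0 < k := s.pos
    have hk' : (0 : ℝ) < k := by exact_mod_cast hk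
    have hF : ∑ i, (‖Z i ξ‖ ^ 2 - ‖Z i ξ‖ ^ 4 / 6) ≤ (n : ℝ) * (3 / 2) := by
      refine (Finset.sum_le_sum fun i _ => hquad _).trans ?_
      simp
    have hs : H s ξ ≤ ∑ s, H s ξ := Finset.single_le_sum (fun s _ => hH0 s ξ) (Finset.mem_univ s)
    have hb : (n / (160 * k) : ℝ) * H s ξ ≤ n * (3 / 2) + n / 40 := by
      have : (n / (160 * k) : ℝ) * H s ξ ≤ (n / (160 * k) : ℝ) * ∑ s, H s ξ := by gcongr
      linarith
    -- The number is `160 * (3 / 2 + 1 / 40)`; it is rounded up to 250 below, and `exp |x| ≤ 2 cosh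
    -- x` makes this 500. The factor 2 in the final bound comes from adding real and imaginary
    -- parts.
    have hH244 : H s ξ ≤ 244 * k := by
      have h1 : (n / (160 * k) : ℝ) * (244 * k) = n * (3 / 2) + n / 40 := by
        field_simp
        norm_num
      exact le_of_mul_le_mul_left (hb.trans h1.ge) (by positivity)
    have hre : |(W s ξ).re / δ| ≤ Real.log (2 * (250 * k)) :=
      abs_le_log_of_cosh_le (by linarith [Real.cosh_pos ((W s ξ).im / δ)])
    have him : |(W s ξ).im / δ| ≤ Real.log (2 * (250 * k)) :=
      abs_le_log_of_cosh_le (by linarith [Real.cosh_pos ((W s ξ).re / δ)])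
    rw [abs_div, abs_of_pos hδ, div_le_iff₀ hδ, ← mul_assoc] at hre him
    norm_num at hre him
    linarith [Complex.norm_le_abs_re_add_abs_im (W s ξ)]
  · intro i hi
    rw [hinner]
    exact (Finset.mem_filter.1 hi).2
  · have hpos : 0 ≤ (n / (160 * k) : ℝ) * ∑ s, H s ξ :=
      mul_nonneg (by positivity) (Finset.sum_nonneg fun s _ => hH0 s ξ)
    have hle : ∑ i, (‖Z i ξ‖ ^ 2 - ‖Z i ξ‖ ^ 4 / 6) ≤
        ∑ i, ((if 1 / 40 ≤ ‖Z i ξ‖ ^ 2 then (3 / 2 : ℝ) else 0) + 1 / 40) := by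
      refine Finset.sum_le_sum fun i _ => ?_
      split_ifs with h
      · linarith [hquad ‖Z i ξ‖]
      · push Not at h
        have : 0 ≤ ‖Z i ξ‖ ^ 4 := by positivity
        linarith
    rw [Finset.sum_add_distrib, ← Finset.sum_filter] at hle
    simp only [Finset.sum_const, Finset.card_univ, Fintype.card_fin, nsmul_eq_mul] at hle
    linarith

end BoundedCoeff
-- Characters, and the determinantal inequality for cyclic convolution
namespace BoundedCoeff

open ComplexConjugate

/-- The `n`-th root of unity `exp (2πi / n)`. -/
noncomputable def rootOfUnity (n : ℕ) : ℂ := Complex.exp (2 * Real.pi * Complex.I / n)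

theorem isPrimitiveRoot_rootOfUnity {n : ℕ} (hn : n ≠ 0) : IsPrimitiveRoot (rootOfUnity n) n :=
  Complex.isPrimitiveRoot_exp n hn

theorem norm_rootOfUnity {n : ℕ} (hn : n ≠ 0) : ‖rootOfUnity n‖ = 1 :=
  (isPrimitiveRoot_rootOfUnity hn).norm'_eq_one hn

/-- The normalized characters of the cyclic group of order `n`. -/
noncomputable def character (n : ℕ) (i : Fin n) : EuclideanSpace ℂ (Fin n) :=
  WithLp.toLp 2 fun t => rootOfUnity n ^ ((i : ℕ) * t) / (Real.sqrt n : ℂ)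

theorem conj_rootOfUnity_pow_mul {n : ℕ} (hn : n ≠ 0) (k : ℕ) :
    conj (rootOfUnity n ^ k) * rootOfUnity n ^ k = 1 := by
  rw [Complex.conj_mul', norm_pow, norm_rootOfUnity hn]
  simp

theorem sqrt_cast_mul_self (n : ℕ) : (Real.sqrt n : ℂ) * (Real.sqrt n : ℂ) = n := by
  rw [← Complex.ofReal_mul, Real.mul_self_sqrt (Nat.cast_nonneg n)]
  simp

theorem orthonormal_character {n : ℕ} (hn : n ≠ 0) : Orthonormal ℂ (character n) := by
  rw [orthonormal_iff_ite]
  intro i j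
  have hn' : (n : ℂ) ≠ 0 := by exact_mod_cast hn
  have hζ := isPrimitiveRoot_rootOfUnity hn
  set ζ := rootOfUnity n with hζdef
  have hterm (t : Fin n) : inner ℂ (character n i t) (character n j t) =
      (conj (ζ ^ (i : ℕ)) * ζ ^ (j : ℕ)) ^ (t : ℕ) / n := by
    simp only [character, RCLike.inner_apply, map_div₀, Complex.conj_ofReal]
    rw [div_mul_div_comm, sqrt_cast_mul_self, mul_pow, map_pow, map_pow, ← pow_mul, ← pow_mul,
      mul_comm]
  rw [PiLp.inner_apply]
  simp only [hterm]
  rw [← Finset.sum_div, Fin.sum_univ_eq_sum_range fun t => (conj (ζ ^ (i : ℕ)) * ζ ^ (j : ℕ)) ^ t]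
  split_ifs with h
  · subst h
    simp only [hζdef, conj_rootOfUnity_pow_mul hn, one_pow]
    simp [hn']
  · rw [div_eq_zero_iff]
    left
    have hw : (conj (ζ ^ (i : ℕ)) * ζ ^ (j : ℕ)) ^ n = 1 := by
      rw [mul_pow, ← map_pow, ← pow_mul, ← pow_mul, mul_comm (i : ℕ), mul_comm (j : ℕ), pow_mul,
        pow_mul, hζ.pow_eq_one]
      simp
    have hne : conj (ζ ^ (i : ℕ)) * ζ ^ (j : ℕ) ≠ 1 := by
      intro hc
      have h1 := conj_rootOfUnity_pow_mul hn (i : ℕ)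
      have h0 : conj (ζ ^ (i : ℕ)) ≠ 0 := left_ne_zero_of_mul_eq_one hc
      have := mul_left_cancel₀ h0 (hc.trans h1.symm)
      exact h (Fin.ext (hζ.pow_inj j.2 i.2 this).symm)
    have := mul_neg_geom_sum (conj (ζ ^ (i : ℕ)) * ζ ^ (j : ℕ)) n
    rw [hw, sub_self] at this
    exact (mul_eq_zero.1 this).resolve_left (sub_ne_zero.2 hne.symm)

theorem sum_ite_modEq {M : Type*} [AddCommMonoid M] {n : ℕ} (s k : Fin n) (f : Fin n → M) :
    ∃ t₀ : Fin n, (s : ℕ) + t₀ ≡ k [MOD n] ∧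
      ∑ t : Fin n, (if (s : ℕ) + t ≡ k [MOD n] then f t else 0) = f t₀ := by
  have hn : 0 < n := s.pos
  have h0 : (s : ℕ) + (k + (n - s)) % n ≡ k [MOD n] := by
    have h1 : (s : ℕ) + (k + (n - s)) % n ≡ s + (k + (n - s)) [MOD n] :=
      Nat.ModEq.add_left _ (Nat.mod_modEq _ _)
    have h2 : (s : ℕ) + (k + (n - s)) = k + n := by omega
    rw [h2] at h1
    exact h1.trans (by simp [Nat.ModEq])
  refine ⟨⟨(k + (n - s)) % n, Nat.mod_lt _ hn⟩, h0, ?_⟩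
  have hiff (t : Fin n) : ((s : ℕ) + t ≡ k [MOD n]) ↔
      t = ⟨(k + (n - s)) % n, Nat.mod_lt _ hn⟩ := by
    constructor
    · intro h
      have := Nat.ModEq.add_left_cancel' _ (h.trans h0.symm)
      rw [Nat.ModEq, Nat.mod_eq_of_lt t.2, Nat.mod_mod] at this
      exact Fin.ext this
    · rintro rfl
      exact h0
  simp only [hiff, Finset.sum_ite_eq', Finset.mem_univ, if_true]

/-- Characters diagonalize convolution by `a`; the eigenvalue is `√n` times the Fourier coefficient
of `a`. -/
theorem conv_character {n : ℕ} (a : EuclideanSpace ℂ (Fin n)) (i k : Fin n) :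
    conv n a (character n i) k =
      (Real.sqrt n * inner ℂ (character n i) a) * character n i k := by
  have hn : n ≠ 0 := i.pos.ne'
  have hs : (Real.sqrt n : ℂ) ≠ 0 := by
    have : (0 : ℝ) < n := by exact_mod_cast i.pos
    exact_mod_cast (Real.sqrt_pos.2 this).ne'
  have hζ := isPrimitiveRoot_rootOfUnity hn
  simp only [conv, LinearMap.mk₂_apply, PiLp.inner_apply, Finset.mul_sum, Finset.sum_mul]
  refine Finset.sum_congr rfl fun s _ => ?_
  obtain ⟨t, ht, hsum⟩ := sum_ite_modEq s k fun t => a s * character n i t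
  rw [hsum]
  simp only [character, RCLike.inner_apply, map_div₀, Complex.conj_ofReal]
  have hpow : rootOfUnity n ^ ((i : ℕ) * k) =
      rootOfUnity n ^ ((i : ℕ) * s) * rootOfUnity n ^ ((i : ℕ) * t) := by
    rw [← pow_add, ← mul_add, pow_eq_pow_mod _ hζ.pow_eq_one,
      pow_eq_pow_mod ((i : ℕ) * (s + t)) hζ.pow_eq_one]
    exact congrArg _ (Nat.ModEq.mul_left _ ht.symm)
  rw [hpow]
  field_simp
  linear_combination (-a s * rootOfUnity n ^ ((i : ℕ) * t)) *
    conj_rootOfUnity_pow_mul hn ((i : ℕ) * s)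

/-- The determinantal inequality behind the lower bound. -/
theorem pow_le_of_computes_conv {n : ℕ} (hn : 5 ≤ n) {Γ : BilinearCircuit n n}
    (hb : Γ.IsBounded) (hc : Γ.Computes (conv n)) :
    ((n : ℝ) / 40) ^ (n / 5) ≤ 2 ^ n * (2 ^ (Γ.r₁ + Γ.r₂ + Γ.r₄) *
      (2 * Real.log (500 * (n + Γ.r₁ : ℕ))) ^ (n / 5)) ^ 2 := by
  have hn0 : n ≠ 0 := by omega
  have hnpos : (0 : ℝ) < n := by exact_mod_cast Nat.pos_of_ne_zero hn0
  set q := n / 5 with hq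
  have hq0 : 0 < q := by omega
  have hq' : (q : ℝ) ≠ 0 := by exact_mod_cast hq0.ne'
  have : NeZero q := ⟨hq0.ne'⟩
  obtain ⟨hbl, hbr, hbf⟩ := hb
  obtain ⟨F, hF⟩ := Γ.left.exists_coeff
  -- The conjugate compensates for the inner product being antilinear in its first argument.
  set v : Fin (n + Γ.r₁) → EuclideanSpace ℂ (Fin n) :=
    fun s => WithLp.toLp 2 fun j => conj (F s j) with hv
  have hinner (s) (x : EuclideanSpace ℂ (Fin n)) : inner ℂ (v s) x = Γ.left.result x s := by
    rw [hF, PiLp.inner_apply]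
    simp [hv, mul_comm]
  set δ : ℝ := 2 ^ ((Γ.r₁ : ℝ) / q) with hδdef
  have hδ : 0 < δ := Real.rpow_pos_of_pos two_pos _
  have hδq : δ ^ q = 2 ^ Γ.r₁ := by
    rw [hδdef, ← Real.rpow_natCast, ← Real.rpow_mul (by norm_num), div_mul_cancel₀ _ hq',
      Real.rpow_natCast]
  rcases exists_rigid_or_triangular v δ hδ.le q with ⟨m, hm, e, he, hres⟩ | ⟨e, t, he, -, htri, hd⟩
  swap
  -- The triangular family has a determinant of modulus above `δ ^ q = 2 ^ r₁`, more than the left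
  -- circuit can produce from orthonormal inputs.
  · exfalso
    have h1 := Γ.left.norm_det_result_le (fun j => e j) zero_le_one
      (norm_det_le_one_of_orthonormal he) hbl t
    simp only [← hinner] at h1
    rw [Matrix.det_of_isLowerTriangular (Matrix.of fun i j => inner ℂ (v (t i)) (e j))
      fun i j hij => htri i j hij, norm_prod, mul_one,
      ← hδq] at h1
    have h2 : ∏ _i : Fin q, δ < ∏ i, ‖inner ℂ (v (t i)) (e i)‖ :=
      Finset.prod_lt_prod_of_nonempty (fun _ _ => hδ) (fun i _ => hd i) Finset.univ_nonempty
    simp only [Finset.prod_const, Finset.card_univ, Fintype.card_fin] at h2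
    exact absurd h1 (not_le.2 h2)
  obtain ⟨a, Q, hsmall, hlarge, hcard⟩ := exists_small_functionals_large_coordinates
    (Nat.pos_of_ne_zero hn0) (by omega) (orthonormal_character hn0) he v hδ hres
  -- From `m ≤ n / 5`, the count is at least `4n / 15 - n / 30 = 7n / 30`.
  have hQ : q ≤ Q.card := by
    have h1 : 5 * (m : ℝ) ≤ n := by exact_mod_cast (by omega : 5 * m ≤ n)
    have h2 : 5 * (q : ℝ) ≤ n := by exact_mod_cast (by omega : 5 * q ≤ n)
    have : (q : ℝ) ≤ Q.card := by linarith
    exact_mod_cast this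
  obtain ⟨Q', hQ', hQ'card⟩ := Finset.exists_subset_card_eq hQ
  set u : Fin q → Fin n := ⇑(Q'.orderEmbOfFin hQ'card) with hu
  have hu_mem (j) : u j ∈ Q := hQ' (Q'.orderEmbOfFin_mem hQ'card j)
  have horth : Orthonormal ℂ fun j => character n (u j) :=
    (orthonormal_character hn0).comp u (Q'.orderEmbOfFin hQ'card).injective
  obtain ⟨p, hp⟩ := exists_one_le_two_pow_mul_normSq_det horth
  set B : ℝ := 2 * δ * Real.log (500 * (n + Γ.r₁ : ℕ)) with hB
  have hBq : B ^ q = 2 ^ Γ.r₁ * (2 * Real.log (500 * (n + Γ.r₁ : ℕ))) ^ q := by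
    rw [← hδq, ← mul_pow, hB]
    ring
  have hB0 : 0 ≤ B := (norm_nonneg _).trans (hsmall ⟨0, by omega⟩)
  have hright := Γ.right.norm_det_result_le (fun j => character n (u j)) zero_le_one
    (norm_det_le_one_of_orthonormal horth) hbr
  -- With `a` fixed, each multiplication scales a row of right-hand values by a number of modulus at
  -- most `B`.
  have hprod (w : Fin q → Fin Γ.r₃) :
      ‖(Matrix.of fun i j => Γ.products a (character n (u j)) (w i)).det‖ ≤
        B ^ q * 2 ^ Γ.r₂ := by
    have h1 := Matrix.det_mul_column (fun i => Γ.left.result a (Γ.factors (w i)).1)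
      (Matrix.of fun i j => Γ.right.result (character n (u j)) (Γ.factors (w i)).2)
    change (Matrix.of fun i j => Γ.products a (character n (u j)) (w i)).det = _ at h1
    rw [h1, norm_mul, norm_prod]
    refine mul_le_mul ?_ ((hright _).trans_eq (mul_one _)) (norm_nonneg _) (by positivity)
    refine (Finset.prod_le_prod (fun _ _ => norm_nonneg _) fun i _ => ?_).trans_eq
      (b := ∏ _i : Fin q, B) (by simp)
    rw [← hinner]
    exact hsmall _
  choose c hcomp using hc
  have hupper := Γ.final.norm_det_result_le (fun j => Γ.products a (character n (u j)))
    (by positivity) hprod hbf fun i => c (p i)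
  have hdet : (Matrix.of fun i j => Γ.final.result (Γ.products a (character n (u j)))
      (c (p i))).det = (∏ j, (Real.sqrt n * inner ℂ (character n (u j)) a)) *
        (Matrix.of fun i j => character n (u j) (p i)).det := by
    rw [← Matrix.det_mul_row]
    congr 2
    ext i j
    exact (hcomp (p i) a (character n (u j))).trans (conv_character a (u j) (p i))
  rw [hdet, norm_mul, norm_prod] at hupper
  set P := ∏ j, ‖(Real.sqrt n : ℂ) * inner ℂ (character n (u j)) a‖ with hP
  have hPlow : ((n : ℝ) / 40) ^ q ≤ P ^ 2 := by
    rw [hP, ← Finset.prod_pow]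
    refine Eq.trans_le (b := ∏ _j : Fin q, (n : ℝ) / 40) (by simp [div_pow]) ?_
    refine Finset.prod_le_prod (fun _ _ => by positivity) fun j _ => ?_
    rw [norm_mul, mul_pow, Complex.norm_real, Real.norm_eq_abs, sq_abs, Real.sq_sqrt hnpos.le]
    have := hlarge _ (hu_mem j)
    nlinarith
  set D := ‖(Matrix.of fun i j => character n (u j) (p i)).det‖
  calc ((n : ℝ) / 40) ^ q ≤ P ^ 2 * (2 ^ n * D ^ 2) := by
        nlinarith [sq_nonneg P]
    _ = 2 ^ n * (P * D) ^ 2 := by ring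
    _ ≤ 2 ^ n * (2 ^ Γ.r₄ * (B ^ q * 2 ^ Γ.r₂)) ^ 2 := by gcongr
    _ = _ := by rw [hBq]; ring

end BoundedCoeff
-- Composing linear circuits, and the fast Fourier transform
namespace BoundedCoeff

/-- Some bounded coefficient linear circuit with at most `r` instructions on `n` inputs computes
all functions in `S`. -/
def Reaches (n r : ℕ) (S : Set ((Fin n → ℂ) → ℂ)) : Prop :=
  ∃ r' ≤ r, ∃ Γ : LinearCircuit n r', Γ.IsBounded ∧ ∀ φ ∈ S, ∃ i, ∀ a, Γ.result a i = φ a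

/-- From the functions in `S`, those in `T` can be computed by `c` further instructions. -/
def Derives {n : ℕ} (c : ℕ) (S T : Set ((Fin n → ℂ) → ℂ)) : Prop :=
  ∀ r U, S ⊆ U → Reaches n r U → Reaches n (r + c) (U ∪ T)

section circuits

variable {n c c' : ℕ} {S S' T T' : Set ((Fin n → ℂ) → ℂ)}

theorem Reaches.mono {r r' : ℕ} (h : Reaches n r T) (hr : r ≤ r') (hS : S ⊆ T) :
    Reaches n r' S := by
  obtain ⟨r₀, hr₀, Γ, hb, hΓ⟩ := h
  exact ⟨r₀, hr₀.trans hr, Γ, hb, fun φ hφ => hΓ φ (hS hφ)⟩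

theorem reaches_inputs : Reaches n 0 (Set.range fun (i : Fin n) a => a i) := by
  refine ⟨0, le_rfl, .nil, trivial, ?_⟩
  rintro _ ⟨i, rfl⟩
  exact ⟨i, fun a => rfl⟩

theorem Derives.mono (h : Derives c S T) (hc : c ≤ c') (hS : S ⊆ S') (hT : T' ⊆ T) :
    Derives c' S' T' := fun r _ hU hr =>
  (h r _ (hS.trans hU) hr).mono (Nat.add_le_add_left hc r) (Set.union_subset_union_right _ hT)

theorem Derives.trans (h : Derives c S T) (h' : Derives c' (S ∪ T) T') :
    Derives (c + c') S (T ∪ T') := fun r U hU hr =>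
  (h' _ _ (Set.union_subset_union_left _ hU) (h r U hU hr)).mono (by omega)
    (by rw [Set.union_assoc])

theorem derives_of_subset (h : T ⊆ S) : Derives 0 S T := fun _ _ hU hr =>
  hr.mono le_rfl (Set.union_subset le_rfl (h.trans hU))

theorem mem_iUnion_lt {α : Type*} {T : ℕ → Set α} {j k : ℕ} {x : α} (hj : j < k) (hx : x ∈ T j) :
    x ∈ ⋃ j < k, T j :=
  Set.mem_iUnion₂.2 ⟨j, hj, hx⟩

theorem derives_iUnion {c : ℕ} : ∀ {k : ℕ} {T : ℕ → Set ((Fin n → ℂ) → ℂ)},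
    (∀ j < k, Derives c S (T j)) → Derives (k * c) S (⋃ j < k, T j)
  | 0, T, _ => (derives_of_subset (Set.empty_subset S)).mono (by simp) le_rfl (by simp)
  | k + 1, T, h => by
    have ih := derives_iUnion fun j (hj : j < k) => h j (by omega)
    have hk := (h k (by omega)).mono le_rfl
      (Set.subset_union_left : S ⊆ S ∪ ⋃ j < k, T j) le_rfl
    refine (ih.trans hk).mono (by rw [Nat.succ_mul]) le_rfl ?_
    refine Set.iUnion₂_subset fun j hj => ?_
    rcases Nat.lt_succ_iff_lt_or_eq.1 hj with h1 | rfl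
    · exact fun x hx => Or.inl (mem_iUnion_lt h1 hx)
    · exact Set.subset_union_right

theorem derives_of_instr {φ : (Fin n → ℂ) → ℂ}
    (h : ∀ r' (Γ : LinearCircuit n r'), (∀ ψ ∈ S, ∃ i, ∀ a, Γ.result a i = ψ a) →
      ∃ ins : LinearInstr (n + r'), ins.IsBounded ∧ ∀ a, ins.eval (Γ.result a) = φ a) :
    Derives 1 S {φ} := by
  rintro r U hU ⟨r', hr', Γ, hb, hΓ⟩
  obtain ⟨ins, hins, hval⟩ := h r' Γ fun ψ hψ => hΓ ψ (hU hψ)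
  refine ⟨r' + 1, by omega, .snoc Γ ins, ⟨hb, hins⟩, ?_⟩
  rintro ψ (hψ | rfl)
  · obtain ⟨i, hi⟩ := hΓ ψ hψ
    exact ⟨Fin.castSucc i, fun a => (Fin.snoc_castSucc (α := fun _ => ℂ) _ _ i).trans (hi a)⟩
  · exact ⟨Fin.last _, fun a => (Fin.snoc_last (α := fun _ => ℂ) _ _).trans (hval a)⟩

theorem derives_add {u v : (Fin n → ℂ) → ℂ} (hu : u ∈ S) (hv : v ∈ S) :
    Derives 1 S {fun a => u a + v a} := derives_of_instr fun r' Γ hΓ => by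
  obtain ⟨i, hi⟩ := hΓ u hu
  obtain ⟨j, hj⟩ := hΓ v hv
  exact ⟨.add i j, trivial, fun a => by rw [← hi, ← hj]; rfl⟩

theorem derives_sub {u v : (Fin n → ℂ) → ℂ} (hu : u ∈ S) (hv : v ∈ S) :
    Derives 1 S {fun a => u a - v a} := derives_of_instr fun r' Γ hΓ => by
  obtain ⟨i, hi⟩ := hΓ u hu
  obtain ⟨j, hj⟩ := hΓ v hv
  exact ⟨.sub i j, trivial, fun a => by rw [← hi, ← hj]; rfl⟩

theorem derives_smul {u : (Fin n → ℂ) → ℂ} (hu : u ∈ S) {z : ℂ} (hz : ‖z‖ ≤ 2) :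
    Derives 1 S {fun a => z * u a} := derives_of_instr fun r' Γ hΓ => by
  obtain ⟨i, hi⟩ := hΓ u hu
  exact ⟨.smul z i, hz, fun a => by rw [← hi]; rfl⟩

theorem derives_butterfly {u v : (Fin n → ℂ) → ℂ} (hu : u ∈ S) (hv : v ∈ S) {z : ℂ}
    (hz : ‖z‖ ≤ 2) : Derives 3 S {fun a => u a + z * v a, fun a => u a - z * v a} := by
  have h1 := derives_smul hv hz
  have h2 : Derives 1 (S ∪ {fun a => z * v a}) {fun a => u a + z * v a} :=
    derives_add (Or.inl hu) (Or.inr rfl)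
  have h12 := h1.trans h2
  have h3 : Derives 1 (S ∪ ({fun a => z * v a} ∪ {fun a => u a + z * v a}))
      {fun a => u a - z * v a} := derives_sub (Or.inl hu) (Or.inr (Or.inl rfl))
  refine (h12.trans h3).mono le_rfl le_rfl ?_
  rintro _ (rfl | rfl)
  · exact Or.inl (Or.inr rfl)
  · exact Or.inr rfl

/-- The discrete Fourier transform of length `N` of a sequence of functions. -/
def dft {α : Type*} (N : ℕ) (ω : ℂ) (x : ℕ → α → ℂ) (t : ℕ) : α → ℂ :=
  fun a => ∑ j ∈ Finset.range N, ω ^ (j * t) * x j a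

theorem sum_range_two_mul {M : Type*} [AddCommMonoid M] (f : ℕ → M) (m : ℕ) :
    ∑ j ∈ Finset.range (2 * m), f j =
      ∑ j ∈ Finset.range m, f (2 * j) + ∑ j ∈ Finset.range m, f (2 * j + 1) := by
  induction m with
  | zero => simp
  | succ m ih =>
    rw [mul_add_one, Finset.sum_range_succ, Finset.sum_range_succ, ih, Finset.sum_range_succ,
      Finset.sum_range_succ]
    abel

theorem dft_two_mul {α : Type*} (m : ℕ) (ω : ℂ) (x : ℕ → α → ℂ) (t : ℕ) (a : α) :
    dft (2 * m) ω x t a = dft m (ω ^ 2) (fun j => x (2 * j)) t a +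
      ω ^ t * dft m (ω ^ 2) (fun j => x (2 * j + 1)) t a := by
  simp only [dft, sum_range_two_mul, Finset.mul_sum]
  congr 1
  · refine Finset.sum_congr rfl fun j _ => ?_
    rw [← pow_mul]
    ring_nf
  · refine Finset.sum_congr rfl fun j _ => ?_
    rw [← pow_mul]
    ring

theorem dft_add_self {α : Type*} {m : ℕ} {ω : ℂ} (hω : ω ^ m = 1) (x : ℕ → α → ℂ) (t : ℕ) :
    dft m ω x (t + m) = dft m ω x t := by
  funext a
  refine Finset.sum_congr rfl fun j _ => ?_
  rw [mul_add, pow_add, mul_comm j m, pow_mul ω m, hω, one_pow, mul_one]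

/-- The fast Fourier transform. -/
theorem derives_dft {n : ℕ} : ∀ (k : ℕ) {S : Set ((Fin n → ℂ) → ℂ)} {ω : ℂ} (_ : IsPrimitiveRoot ω (2 ^ k))
    {x : ℕ → (Fin n → ℂ) → ℂ} (_ : ∀ j < 2 ^ k, x j ∈ S),
    Derives (3 * k * 2 ^ k) S (⋃ t < 2 ^ k, {dft (2 ^ k) ω x t})
  | 0, S, ω, _, x, hx => by
    refine (derives_of_subset ?_).mono (by simp) le_rfl le_rfl
    refine Set.iUnion₂_subset fun t _ => ?_
    rintro _ rfl
    convert hx 0 (by simp) using 1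
    funext a
    have : t = 0 := by simp at *; omega
    simp [dft, this]
  | k + 1, S, ω, hω, x, hx => by
    have hpow : 2 ^ (k + 1) = 2 * 2 ^ k := pow_succ' 2 k
    have hω2 : IsPrimitiveRoot (ω ^ 2) (2 ^ k) := hω.pow (by positivity) hpow
    -- This lets the outputs at `t` and `t + 2 ^ k` share one butterfly.
    have hhalf : ω ^ 2 ^ k = -1 := by
      have h1 : (ω ^ 2 ^ k) ^ 2 = 1 := by rw [← pow_mul, ← pow_succ, hω.pow_eq_one]
      have h2 : ω ^ 2 ^ k ≠ 1 := hω.pow_ne_one_of_pos_of_lt (by positivity)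
        (Nat.pow_lt_pow_right (by norm_num) (by omega))
      exact (mul_self_eq_one_iff.1 ((sq _).symm.trans h1)).resolve_left h2
    have hnorm (t : ℕ) : ‖ω ^ t‖ ≤ 2 := by
      rw [norm_pow, hω.norm'_eq_one (by positivity), one_pow]
      norm_num
    set E := dft (2 ^ k) (ω ^ 2) fun j => x (2 * j) with hE
    set O := dft (2 ^ k) (ω ^ 2) fun j => x (2 * j + 1) with hO
    have hev := derives_dft k hω2 (S := S) (x := fun j => x (2 * j)) fun j hj => hx _ (by omega)
    have hod := (derives_dft k hω2 (S := S) (x := fun j => x (2 * j + 1))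
      fun j hj => hx _ (by omega)).mono le_rfl
      (Set.subset_union_left : S ⊆ S ∪ ⋃ t < 2 ^ k, {E t}) le_rfl
    have hbut := derives_iUnion (k := 2 ^ k) fun t (ht : t < 2 ^ k) => derives_butterfly
      (S := S ∪ ((⋃ t < 2 ^ k, {E t}) ∪ ⋃ t < 2 ^ k, {O t})) (u := E t) (v := O t)
      (Or.inr (Or.inl (mem_iUnion_lt ht rfl)))
      (Or.inr (Or.inr (mem_iUnion_lt ht rfl))) (hnorm t)
    refine ((hev.trans hod).trans hbut).mono (by rw [hpow]; nlinarith [Nat.zero_le (2 ^ k)]) le_rfl ?_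
    refine Set.iUnion₂_subset fun t ht => ?_
    rintro _ rfl
    refine Or.inr ?_
    rcases lt_or_ge t (2 ^ k) with h | h
    · refine mem_iUnion_lt h (Or.inl ?_)
      funext a
      rw [hpow, dft_two_mul]
    · obtain ⟨t', rfl⟩ := Nat.exists_eq_add_of_le' h
      refine mem_iUnion_lt (j := t') (show t' < 2 ^ k by omega) (Or.inr ?_)
      funext a
      rw [hpow, dft_two_mul, dft_add_self hω2.pow_eq_one, dft_add_self hω2.pow_eq_one, pow_add,
        hhalf]
      ring

/-- The convolution theorem modulo `N`, from orthogonality of the powers of `ω`. -/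
theorem sum_dft_mul_dft {α β : Type*} {N : ℕ} {ω : ℂ} (hω : IsPrimitiveRoot ω N)
    (x : ℕ → α → ℂ) (y : ℕ → β → ℂ) (a : α) (b : β) {u : ℕ} (hu : u < N) :
    ∑ t ∈ Finset.range N, ω⁻¹ ^ (t * u) * (dft N ω x t a * dft N ω y t b) =
      N * ∑ i ∈ Finset.range N, ∑ j ∈ Finset.range N,
        if i + j ≡ u [MOD N] then x i a * y j b else 0 := by
  have hN : N ≠ 0 := by omega
  have hω0 : ω ≠ 0 := hω.ne_zero hN
  have horth (w : ℕ) : ∑ t ∈ Finset.range N, ω⁻¹ ^ (t * u) * ω ^ (w * t) =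
      if w ≡ u [MOD N] then (N : ℂ) else 0 := by
    have hterm (t : ℕ) : ω⁻¹ ^ (t * u) * ω ^ (w * t) = (ω⁻¹ ^ u * ω ^ w) ^ t := by
      rw [mul_pow, ← pow_mul, ← pow_mul, mul_comm t u]
    have hz : (ω⁻¹ ^ u * ω ^ w) ^ N = 1 := by
      rw [mul_pow, ← pow_mul, ← pow_mul, mul_comm u, mul_comm w, pow_mul, pow_mul, inv_pow,
        hω.pow_eq_one]
      simp
    simp only [hterm]
    have hone : ω⁻¹ ^ u * ω ^ w = 1 ↔ w ≡ u [MOD N] := by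
      rw [inv_pow, inv_mul_eq_one₀ (pow_ne_zero _ hω0), pow_eq_pow_mod u hω.pow_eq_one,
        pow_eq_pow_mod w hω.pow_eq_one]
      constructor
      · intro h
        exact (hω.pow_inj (Nat.mod_lt _ (by omega)) (Nat.mod_lt _ (by omega)) h).symm
      · intro h
        exact congrArg _ (Nat.ModEq.symm h)
    split_ifs with h
    · simp only [hone.2 h, one_pow]
      simp
    · have := mul_neg_geom_sum (ω⁻¹ ^ u * ω ^ w) N
      rw [hz, sub_self] at this
      exact (mul_eq_zero.1 this).resolve_left (sub_ne_zero.2 fun hc => h (hone.1 hc.symm))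
  simp_rw [dft, Finset.sum_mul_sum, Finset.mul_sum]
  rw [Finset.sum_comm]
  refine Finset.sum_congr rfl fun i _ => ?_
  rw [Finset.sum_comm]
  refine Finset.sum_congr rfl fun j _ => ?_
  have := congrArg (· * (x i a * y j b)) (horth (i + j))
  simp only [Finset.sum_mul, ite_mul, zero_mul] at this
  rw [mul_ite, mul_zero, ← this]
  refine Finset.sum_congr rfl fun t _ => ?_
  rw [add_mul, pow_add]
  ring

/-- The input sequence, continued by zeros. -/
def paddedInput (n j : ℕ) : (Fin n → ℂ) → ℂ :=
  fun a => if h : j < n then a ⟨j, h⟩ else 0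

theorem sum_range_paddedInput {n N : ℕ} (h : n ≤ N) (a : Fin n → ℂ) (g : ℕ → ℂ → ℂ)
    (hg : ∀ i, g i 0 = 0) :
    ∑ i ∈ Finset.range N, g i (paddedInput n i a) = ∑ i : Fin n, g i (a i) := by
  rw [← Finset.sum_subset (Finset.range_mono h) fun i _ hi => by
    rw [paddedInput, dif_neg (by simpa using hi), hg], Finset.sum_range]
  exact Finset.sum_congr rfl fun i _ => by simp [paddedInput]

theorem reaches_dft_paddedInput (hn : 0 < n) (k : ℕ) :
    Reaches n (1 + 3 * k * 2 ^ k)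
      (⋃ t < 2 ^ k, {dft (2 ^ k) (rootOfUnity (2 ^ k)) (paddedInput n) t}) := by
  -- The zero used for padding has to be computed, as `a 0 - a 0`; this is the extra instruction in
  -- the bound.
  have h0 := derives_sub (n := n) (S := Set.range fun (i : Fin n) a => a i)
    (u := fun a => a ⟨0, hn⟩) (v := fun a => a ⟨0, hn⟩) ⟨_, rfl⟩ ⟨_, rfl⟩
  have h1 := h0.trans (derives_dft k (isPrimitiveRoot_rootOfUnity (by positivity))
    (x := paddedInput n) fun j _ => by
      by_cases hj : j < n
      · exact Or.inl ⟨⟨j, hj⟩, by funext a; simp [paddedInput, hj]⟩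
      · exact Or.inr (by funext a; simp [paddedInput, hj]))
  have h2 := h1 0 _ le_rfl reaches_inputs
  exact h2.mono (by omega) (Set.subset_union_right.trans Set.subset_union_right)

/-- As `i + j < 2 * n ≤ N`, nothing wraps around modulo `N`, and `i + j ≡ s` modulo `n` means that
`i + j` is `s` or `s + n`. -/
theorem conv_eq_sum_add_sum {n N : ℕ} (hN : 2 * n ≤ N) (a b : Fin n → ℂ) (s : Fin n) :
    conv n a b s =
      (∑ i ∈ Finset.range N, ∑ j ∈ Finset.range N,
        if i + j ≡ s [MOD N] then paddedInput n i a * paddedInput n j b else 0) +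
      ∑ i ∈ Finset.range N, ∑ j ∈ Finset.range N,
        if i + j ≡ s + n [MOD N] then paddedInput n i a * paddedInput n j b else 0 := by
  have hsum (u : ℕ) : (∑ i ∈ Finset.range N, ∑ j ∈ Finset.range N,
      if i + j ≡ u [MOD N] then paddedInput n i a * paddedInput n j b else 0) =
      ∑ i : Fin n, ∑ j : Fin n, if (i : ℕ) + j ≡ u [MOD N] then a i * b j else 0 := by
    rw [sum_range_paddedInput (by omega) a (fun i z => ∑ j ∈ Finset.range N,
      if i + j ≡ u [MOD N] then z * paddedInput n j b else 0) (by simp)]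
    refine Finset.sum_congr rfl fun i _ => ?_
    exact sum_range_paddedInput (by omega) b
      (fun j z => if (i : ℕ) + j ≡ u [MOD N] then a i * z else 0) (by simp)
  rw [hsum, hsum, ← Finset.sum_add_distrib]
  simp only [conv, LinearMap.mk₂_apply]
  refine Finset.sum_congr rfl fun i _ => ?_
  rw [← Finset.sum_add_distrib]
  refine Finset.sum_congr rfl fun j _ => ?_
  have hlt (u w : ℕ) (hu : u < N) (hw : w < N) : u ≡ w [MOD N] ↔ u = w := by
    rw [Nat.ModEq, Nat.mod_eq_of_lt hu, Nat.mod_eq_of_lt hw]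
  have hn : (i : ℕ) + j ≡ s [MOD n] ↔ (i : ℕ) + j = s ∨ (i : ℕ) + j = s + n := by
    have := i.2
    have := j.2
    have := s.2
    rw [Nat.ModEq, Nat.mod_eq_of_lt s.2]
    rcases lt_or_ge ((i : ℕ) + j) n with h | h
    · rw [Nat.mod_eq_of_lt h]; omega
    · rw [Nat.mod_eq_sub_mod h, Nat.mod_eq_of_lt (by omega)]; omega
  simp only [hn, hlt (i + j) s (by omega) (by omega), hlt (i + j) (s + n) (by omega) (by omega)]
  have := s.pos
  by_cases h1 : (i : ℕ) + j = s
  · rw [if_pos (Or.inl h1), if_pos h1, if_neg (by omega), add_zero]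
  · by_cases h2 : (i : ℕ) + j = s + n
    · rw [if_pos (Or.inr h2), if_neg h1, if_pos h2, zero_add]
    · rw [if_neg (by tauto), if_neg h1, if_neg h2, zero_add]

/-- Convolution by fast Fourier transforms of length `2 ^ k`. -/
theorem exists_circuit_computes_conv {n k : ℕ} (hn : 0 < n) (hk : 2 * n ≤ 2 ^ k) :
    ∃ Γ : BilinearCircuit n n, Γ.IsBounded ∧ Γ.Computes (conv n) ∧
      Γ.size ≤ 9 * k * 2 ^ k + 2 * 2 ^ k + n + 2 := by
  set N := 2 ^ k with hNdef
  have hN : N ≠ 0 := by positivity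
  obtain ⟨r, hr, Γ, hb, hΓ⟩ := reaches_dft_paddedInput hn k
  have hidx (t : Fin N) : ∃ i, ∀ a, Γ.result a i =
      dft N (rootOfUnity N) (paddedInput n) t a :=
    hΓ _ (mem_iUnion_lt t.2 rfl)
  choose idx hidx using hidx
  set P : ℕ → (Fin N → ℂ) → ℂ := paddedInput N
  set D : ℕ → (Fin N → ℂ) → ℂ := dft N (rootOfUnity N)⁻¹ P with hD
  have h1 := derives_dft k (isPrimitiveRoot_rootOfUnity hN).inv
    (S := Set.range fun (i : Fin N) a => a i) (x := P) fun j hj =>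
      ⟨⟨j, hj⟩, by funext a; simp [P, paddedInput, show j < N from hj]⟩
  have h2 := h1.trans (derives_iUnion (k := N) fun t (ht : t < N) =>
    derives_smul (u := D t) (z := (N : ℂ)⁻¹)
      (Or.inr (mem_iUnion_lt (T := fun t => {D t}) ht rfl)) (by
        rw [norm_inv, Complex.norm_natCast]
        have : (1 : ℝ) ≤ N := by exact_mod_cast Nat.one_le_iff_ne_zero.2 hN
        exact (inv_le_one_of_one_le₀ this).trans one_le_two))
  have h3 := h2.trans (derives_iUnion (k := n) fun s (hs : s < n) =>
    derives_add (u := fun a => (N : ℂ)⁻¹ * D s a) (v := fun a => (N : ℂ)⁻¹ * D (s + n) a)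
      (Or.inr (Or.inr (mem_iUnion_lt (T := fun t => {fun a => (N : ℂ)⁻¹ * D t a})
        (show s < N by omega) rfl)))
      (Or.inr (Or.inr (mem_iUnion_lt (T := fun t => {fun a => (N : ℂ)⁻¹ * D t a})
        (show s + n < N by omega) rfl))))
  obtain ⟨r₄, hr₄, Γ₄, hb₄, hΓ₄⟩ := h3 0 _ le_rfl reaches_inputs
  -- The same transform serves both inputs. The last part is an inverse transform, `N` scalings by
  -- `1 / N` and `n` additions that fold the result modulo `n`.
  refine ⟨⟨r, r, N, r₄, Γ, Γ, fun t => (idx t, idx t), Γ₄⟩, ⟨hb, hb, hb₄⟩, fun s => ?_, ?_⟩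
  · obtain ⟨i, hi⟩ := hΓ₄ _ (Or.inr (Or.inr (mem_iUnion_lt s.2 rfl)))
    refine ⟨i, fun a b => (hi _).trans ?_⟩
    have hval (u : ℕ) (hu : u < N) : (N : ℂ)⁻¹ * D u (fun t => Γ.result a (idx t) *
        Γ.result b (idx t)) = ∑ i ∈ Finset.range N, ∑ j ∈ Finset.range N,
        if i + j ≡ u [MOD N] then paddedInput n i a * paddedInput n j b else 0 := by
      have hNC : (N : ℂ) ≠ 0 := by exact_mod_cast hN
      rw [inv_mul_eq_iff_eq_mul₀ hNC,
        ← sum_dft_mul_dft (isPrimitiveRoot_rootOfUnity hN) _ _ _ _ hu]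
      refine Finset.sum_congr rfl fun t ht => ?_
      have ht' := Finset.mem_range.1 ht
      simp [P, paddedInput, ht', hidx]
    have hs := s.2
    rw [conv_eq_sum_add_sum hk, ← hval _ (by omega), ← hval _ (by omega)]
    rfl
  · simp only [BilinearCircuit.size]
    have : 9 * k * N = 3 * (3 * k * N) := by ring
    rw [← hNdef] at *
    omega

theorem exists_circuit_computes_conv_size_le {n : ℕ} (hn : 2 ≤ n) :
    ∃ Γ : BilinearCircuit n n, Γ.IsBounded ∧ Γ.Computes (conv n) ∧
      (Γ.size : ℝ) ≤ 120 * (n * Real.logb 2 n) := by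
  have hlow : 2 * n ≤ 2 ^ (Nat.log 2 n + 2) := by
    have := Nat.lt_pow_succ_log_self (b := 2) (by norm_num) n
    rw [pow_succ]
    omega
  have hhigh : 2 ^ (Nat.log 2 n + 2) ≤ 4 * n := by
    have := Nat.pow_log_le_self 2 (x := n) (by omega)
    rw [pow_add]
    omega
  obtain ⟨Γ, hb, hc, hsize⟩ := exists_circuit_computes_conv (by omega) hlow
  refine ⟨Γ, hb, hc, ?_⟩
  have hn' : (2 : ℝ) ≤ n := by exact_mod_cast hn
  have hlog1 : 1 ≤ Real.logb 2 n := by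
    rw [Real.le_logb_iff_rpow_le (by norm_num) (by linarith)]
    simpa using hn'
  have hlog2 : (Nat.log 2 n : ℝ) ≤ Real.logb 2 n := by
    rw [Real.le_logb_iff_rpow_le (by norm_num) (by linarith), Real.rpow_natCast]
    exact_mod_cast Nat.pow_log_le_self 2 (by omega)
  set l := Nat.log 2 n
  have h1 : Γ.size ≤ 9 * (l + 2) * (4 * n) + 2 * (4 * n) + n + 2 := by
    refine hsize.trans ?_
    gcongr
  have h2 : (Γ.size : ℝ) ≤ 9 * (l + 2) * (4 * n) + 2 * (4 * n) + n + 2 := by exact_mod_cast h1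
  have h3 : (n : ℝ) ≤ n * Real.logb 2 n := by nlinarith
  have h4 : (n : ℝ) * l ≤ n * Real.logb 2 n := by gcongr
  nlinarith

end circuits

end BoundedCoeff
-- Passing to logarithms
namespace BoundedCoeff

/-- The lower bound for the size of a circuit with the constant `1 / 10`. -/
theorem size_ge_of_computes_conv {n : ℕ} (hn : 3 ≤ n) {Γ : BilinearCircuit n n}
    (hb : Γ.IsBounded) (hc : Γ.Computes (conv n)) :
    (1 / 10 : ℝ) * (n * Real.logb 2 n) - 6 * (n * Real.logb 2 (Real.logb 2 n)) ≤ Γ.size := by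
  have hn' : (3 : ℝ) ≤ n := by exact_mod_cast hn
  have hn0 : (0 : ℝ) < n := by linarith
  set l := Real.logb 2 n with hl
  have hl1 : 3 / 2 ≤ l := by
    have h1 : Real.logb 2 3 ≤ l := Real.logb_le_logb_of_le (by norm_num) (by norm_num) hn'
    have h2 : Real.logb 2 (2 ^ 3) ≤ Real.logb 2 (3 ^ 2) :=
      Real.logb_le_logb_of_le (by norm_num) (by norm_num) (by norm_num)
    rw [Real.logb_pow, Real.logb_pow, Real.logb_self_eq_one (by norm_num)] at h2
    norm_num at h2
    linarith
  have hll : 1 / 2 ≤ Real.logb 2 l := by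
    have h1 : Real.logb 2 (3 / 2) ≤ Real.logb 2 l :=
      Real.logb_le_logb_of_le (by norm_num) (by norm_num) hl1
    have h2 : Real.logb 2 2 ≤ Real.logb 2 ((3 / 2) ^ 2) :=
      Real.logb_le_logb_of_le (by norm_num) (by norm_num) (by norm_num)
    rw [Real.logb_pow, Real.logb_self_eq_one (by norm_num)] at h2
    norm_num at h2
    linarith
  set ll := Real.logb 2 l with hlldef
  have hln : l ≤ n := by
    rw [hl, Real.logb_le_iff_le_rpow (by norm_num) hn0, Real.rpow_natCast]
    exact_mod_cast n.lt_two_pow_self.le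
  have hnll : (n : ℝ) ≤ 2 * (n * ll) := by nlinarith
  have hsize0 : (0 : ℝ) ≤ Γ.size := Nat.cast_nonneg _
  -- For `n` equal to 3 or 4 the left-hand side is negative, because `l ≤ 4` and `ll ≥ 1 / 2`.
  by_cases h5 : 5 ≤ n
  swap
  · have h4 : (n : ℝ) ≤ 4 := by exact_mod_cast (by omega : n ≤ 4)
    have : l ≤ 4 := hln.trans h4
    nlinarith
  -- A circuit of size at least `n ^ 2` satisfies the bound trivially; otherwise `r₁ < n ^ 2`, and
  -- the logarithmic factor is `O(log n)`.
  by_cases hbig : n ^ 2 ≤ Γ.size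
  · have h1 : ((n ^ 2 : ℕ) : ℝ) ≤ Γ.size := by exact_mod_cast hbig
    push_cast at h1
    nlinarith
  have hmain := pow_le_of_computes_conv h5 hb hc
  set q := n / 5 with hq
  have hq1 : 5 * (q : ℝ) ≤ n := by exact_mod_cast (by omega : 5 * q ≤ n)
  have hq2 : (n : ℝ) ≤ 5 * q + 4 := by exact_mod_cast (by omega : n ≤ 5 * q + 4)
  have hq0 : (0 : ℝ) ≤ q := Nat.cast_nonneg _
  have hlog : 2 * Real.log (500 * (n + Γ.r₁ : ℕ)) ≤ 2 ^ 5 * l := by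
    have h1 : ((n + Γ.r₁ : ℕ) : ℝ) ≤ 2 * n ^ 2 := by
      have h2 : Γ.r₁ ≤ Γ.size := by simp only [BilinearCircuit.size]; omega
      have h3 : n + Γ.r₁ ≤ 2 * n ^ 2 := by nlinarith
      exact_mod_cast h3
    have h2 : Real.log (500 * (n + Γ.r₁ : ℕ)) ≤ Real.log (2 ^ 10 * (n : ℝ) ^ 2) := by
      apply Real.log_le_log
      · push_cast
        positivity
      · nlinarith
    rw [Real.log_mul (x := 2 ^ 10) (by norm_num) (by positivity), Real.log_pow, Real.log_pow] at h2
    have h3 : Real.log n = l * Real.log 2 := by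
      rw [hl, Real.logb, div_mul_cancel₀ _ (Real.log_pos one_lt_two).ne']
    have h4 := Real.log_two_lt_d9
    have h5 := Real.log_pos one_lt_two
    push_cast at h2 ⊢
    rw [h3] at h2
    nlinarith
  have hlogpos : 0 < Real.log (500 * (n + Γ.r₁ : ℕ)) := by
    apply Real.log_pos
    push_cast
    have : (0 : ℝ) ≤ Γ.r₁ := Nat.cast_nonneg _
    linarith
  have hineq : ((n : ℝ) / 40) ^ q ≤ 2 ^ n * (2 ^ (Γ.r₁ + Γ.r₂ + Γ.r₄) * (2 ^ 5 * l) ^ q) ^ 2 :=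
    hmain.trans (by gcongr)
  -- Constants are rounded up to powers of 2, here `40 ≤ 2 ^ 6`, so that their logarithms are
  -- integers.
  have hineq2 : (n : ℝ) ^ q ≤
      2 ^ (6 * q) * (2 ^ n * (2 ^ (Γ.r₁ + Γ.r₂ + Γ.r₄) * (2 ^ 5 * l) ^ q) ^ 2) := by
    calc (n : ℝ) ^ q = 40 ^ q * ((n : ℝ) / 40) ^ q := by
          rw [← mul_pow]
          congr 1
          ring
      _ ≤ 2 ^ (6 * q) * (2 ^ n * (2 ^ (Γ.r₁ + Γ.r₂ + Γ.r₄) * (2 ^ 5 * l) ^ q) ^ 2) := by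
          rw [pow_mul]
          gcongr
          norm_num
  have hlog2 := Real.logb_le_logb_of_le (b := 2) (by norm_num) (by positivity) hineq2
  have hl0 : l ≠ 0 := by linarith
  rw [Real.logb_mul (by positivity) (by positivity), Real.logb_mul (by positivity) (by positivity),
    Real.logb_pow, Real.logb_pow, Real.logb_pow, Real.logb_pow,
    Real.logb_mul (by positivity) (by positivity), Real.logb_pow, Real.logb_pow,
    Real.logb_mul (by positivity) hl0, Real.logb_pow, Real.logb_self_eq_one (by norm_num)] at hlog2
  push_cast at hlog2
  have hsize : (Γ.r₁ : ℝ) + Γ.r₂ + Γ.r₄ ≤ Γ.size := by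
    exact_mod_cast (by simp only [BilinearCircuit.size]; omega : Γ.r₁ + Γ.r₂ + Γ.r₄ ≤ Γ.size)
  rw [← hl, ← hlldef] at hlog2
  have hqll : 5 * (q * ll) ≤ n * ll := by nlinarith
  -- The loss from rounding `n / 5` down; as `l ≤ n ≤ 2 * (n * ll)`, it goes into the error term.
  have hql : (n : ℝ) * l ≤ 5 * (q * l) + 4 * l := by nlinarith
  linarith

theorem bcComplexity_conv_ge {n : ℕ} (hn : 3 ≤ n) {c : ℝ} (hc : c ≤ 1 / 10) :
    c * n * Real.logb 2 n - 6 * (n * Real.logb 2 (Real.logb 2 n)) ≤ bcComplexity (conv n) := by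
  -- The infimum of the empty set of naturals is 0, so a lower bound needs some circuit to exist;
  -- the Fourier circuit provides it.
  obtain ⟨Γ₀, hb₀, hc₀, -⟩ := exists_circuit_computes_conv_size_le (n := n) (by omega)
  obtain ⟨Γ, hb, hcomp, hsize⟩ : bcComplexity (conv n) ∈ {s | ∃ Γ : BilinearCircuit n n,
      Γ.IsBounded ∧ Γ.Computes (conv n) ∧ Γ.size = s} := Nat.sInf_mem ⟨_, Γ₀, hb₀, hc₀, rfl⟩
  rw [← hsize]
  refine le_trans ?_ (size_ge_of_computes_conv hn hb hcomp)
  have hlog : 0 ≤ Real.logb 2 n :=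
    Real.logb_nonneg (by norm_num) (by exact_mod_cast (by omega : 1 ≤ n))
  rw [mul_assoc]
  gcongr

end BoundedCoeff

theorem theorem1 :
    (∃ C : ℝ, ∀ n : ℕ, 3 ≤ n →
      (1 / 12 : ℝ) * n * Real.logb 2 n - C * (n * Real.logb 2 (Real.logb 2 n))
        ≤ (BoundedCoeff.bcComplexity (BoundedCoeff.conv n) : ℝ)) ∧
    (∃ C : ℝ, ∀ n : ℕ, 3 ≤ n →
      (3 / 2 - Real.sqrt 2) * n * Real.logb 2 n - C * (n * Real.logb 2 (Real.logb 2 n))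
        ≤ (BoundedCoeff.bcComplexity (BoundedCoeff.conv n) : ℝ)) ∧
    (∃ C : ℝ, ∀ n : ℕ, 2 ≤ n →
      ∃ Γ : BoundedCoeff.BilinearCircuit n n,
        Γ.IsBounded ∧ Γ.Computes (BoundedCoeff.conv n) ∧
          (Γ.size : ℝ) ≤ C * (n * Real.logb 2 n)) := by
  have h2 : 3 / 2 - Real.sqrt 2 ≤ 1 / 10 := by
    have : (7 / 5 : ℝ) ≤ Real.sqrt 2 := Real.le_sqrt_of_sq_le (by norm_num)
    linarith
  exact ⟨⟨6, fun n hn => BoundedCoeff.bcComplexity_conv_ge hn (by norm_num)⟩,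
    ⟨6, fun n hn => BoundedCoeff.bcComplexity_conv_ge hn h2⟩,
    ⟨120, fun n hn => BoundedCoeff.exists_circuit_computes_conv_size_le hn⟩⟩
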